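/- Let $\mathcal M$ be a von Neumann algebra on a Hilbert space $\mathcal H$, and let $\mathbf M(\mathbf x)=(\mathcal K,\sigma,U,M)$ be a measuring process for $\mathcal M$: $\mathcal K$ is a Hilbert space, $\sigma$ a density operator on $\mathcal K$, $U$ a unitary operator on $\mathcal H\otimes\mathcal K$, and $M$ a self-adjoint operator on $\mathcal K$ with spectral measure $E^M$, such that $\mathrm{Tr}_{\mathcal K}[U^{\dagger}(X\otimes E^{M}(\Delta))U(1\otimes\sigma)]\in\mathcal M$ for all $X\in\mathcal M$ and all Borel sets $\Delta\subseteq\mathbf R$. Put $M(\Delta t)=U^{\dagger}(1\otimes M)U$, and let $$\Pi(\Delta)=\mathrm{Tr}_{\mathcal K}[E^{M(\Delta t)}(\Delta)(1\otimes\sigma)]\qquad(\Delta\subseteq\mathbf R\text{ Borel})$$ be the POVM of $\mathbf M(\mathbf x)$. Two self-adjoint operators $X,Y$ on a Hilbert space are said to be equal in a state (density operator) $\tau$, written $X=_\tau Y$, if $\mathrm{Tr}\big[[\![\tilde X=\tilde Y]\!]\,\tau\big]=1$. Here $[\![\tilde X=\tilde Y]\!]$ is the projection-valued truth value of the equality of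 $\tilde X$ and $\tilde Y$ in the universe $V^{(\mathcal Q)}$ of quantum set theory over the logic $\mathcal Q$ of projections (with the Sasaki implication $P\to Q=P^{\perp}\vee(P\wedge Q)$), and $\tilde X=\{(\check r,E^X((-\infty,r]))\mid r\in\mathbf Q\}$ is the real number in $V^{(\mathcal Q)}$ corresponding to $X$. For a self-adjoint operator $A$ on $\mathcal H$ affiliated with $\mathcal M$ and a density operator $\rho$ on $\mathcal H$, the measuring process $\mathbf M(\mathbf x)$ is said to measure $A$ in $\rho$ if $A\otimes 1=_{\rho\otimes\sigma}M(\Delta t)$. Theorem. Let $A$ be a self-adjoint operator on $\mathcal H$ affiliated with $\mathcal M$, with spectral measure $E^A$. Then $\mathbf M(\mathbf x)$ measures $A$ in $\rho$ for every density operator $\rho$ on $\mathcal H$ if and only if $\Pi(\Delta)=E^A(\Delta)$ for every Borel set $\Delta\subseteq\mathbf R$. -/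

import Mathlib

open MeasureTheory
open scoped TensorProduct InnerProductSpace ENNReal

noncomputable section

namespace QSet

universe u w

/-! ### Quantum set theory over a logic

A logic `Q` is a complete lattice together with an orthocomplementation `ᶜ`. -/

/-- The Sasaki implication `P → Q := Pᗮ ∨ (P ∧ Q)`. -/
def sasaki {Q : Type u} [CompleteLattice Q] [Compl Q] (p q : Q) : Q := pᶜ ⊔ (p ⊓ q)

/-- The `Q`-valued universe `V^(Q)`: a `Q`-valued set is a family of (previously constructed)
`Q`-valued sets, its domain, together with a `Q`-valued function on it. -/
inductive QName (Q : Type u) : Type (max u (w + 1))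
  | mk (ι : Type w) (elt : ι → QName Q) (val : ι → Q) : QName Q

namespace QName

variable {Q : Type u} [CompleteLattice Q] [Compl Q]

/-- The truth value `⟦u = v⟧`, by recursion. The defining equation in its usual form, in terms of
the membership truth value, is `eqVal_eq` below. -/
def eqVal : QName.{u, w} Q → QName.{u, w} Q → Q
  | mk _ A a, mk _ B b =>
    (⨅ i, sasaki (a i) (⨆ j, b j ⊓ eqVal (A i) (B j))) ⊓
      (⨅ j, sasaki (b j) (⨆ i, a i ⊓ eqVal (A i) (B j)))

/-- The truth value `⟦u ∈ v⟧ = sup_{v' ∈ dom v} (v(v') ∧ ⟦u = v'⟧)`. -/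
def memVal (u : QName.{u, w} Q) : QName.{u, w} Q → Q
  | mk _ B b => ⨆ j, b j ⊓ eqVal u (B j)

theorem eqVal_comm (u v : QName.{u, w} Q) : eqVal u v = eqVal v u := by
  induction u generalizing v with
  | mk ι A a ih =>
    cases v with
    | mk κ B b => simp only [eqVal, ih, inf_comm]

/-- The recursion rule for the truth value of equality:
`⟦u = v⟧ = inf_{u' ∈ dom u} (u(u') → ⟦u' ∈ v⟧) ∧ inf_{v' ∈ dom v} (v(v') → ⟦v' ∈ u⟧)`. -/
theorem eqVal_eq (ι κ : Type w) (A : ι → QName.{u, w} Q) (a : ι → Q) (B : κ → QName.{u, w} Q)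
    (b : κ → Q) :
    eqVal (mk ι A a) (mk κ B b) =
      (⨅ i, sasaki (a i) (memVal (A i) (mk κ B b))) ⊓
        (⨅ j, sasaki (b j) (memVal (B j) (mk ι A a))) := by
  simp only [eqVal, memVal, eqVal_comm (B _) (A _)]

/-- The canonical embedding `x ↦ x̌` of the universe of sets into `V^(Q)`:
`x̌ = {y̌ | y ∈ x} × {1}`. -/
def check : PSet.{w} → QName.{u, w} Q
  | PSet.mk ι A => mk ι (fun i => check (A i)) (fun _ => ⊤)

end QName

/-- A set-theoretic code of a rational number: distinct rationals are coded by distinct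
von Neumann numerals. (The truth values below depend only on distinct rationals being distinct
sets, not on the code.) -/
def ratSet (r : ℚ) : PSet.{0} := PSet.ofNat (Encodable.encode r)

/-- The `Q`-valued set `{(ř, e r) | r ∈ ℚ}`, i.e. the (upper segment of the) Dedekind cut in `V^(Q)`
with the values `e r`. -/
def cut {Q : Type u} [CompleteLattice Q] [Compl Q] (e : ℚ → Q) : QName.{u, 0} Q :=
  QName.mk ℚ (fun r => QName.check (ratSet r)) e

end QSet

namespace QMeas

universe u v

section Hilbert

variable {𝓗 : Type u} [NormedAddCommGroup 𝓗] [InnerProductSpace ℂ 𝓗] [CompleteSpace 𝓗]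

/-- The orthocomplementation of the logic `𝒞(𝓗)` of closed subspaces of `𝓗`; this logic is
isomorphic to the logic of all projections on `𝓗`. -/
instance instComplClosedSubmodule : Compl (ClosedSubmodule ℂ 𝓗) := ⟨fun S => S.orthogonal⟩

/-! ### Traces and states -/

/-- `T` has the trace `t`: `∑ᵢ ⟨eᵢ, T eᵢ⟩ = t` for every orthonormal basis `(eᵢ)`. -/
def HasTrace (T : 𝓗 →L[ℂ] 𝓗) (t : ℂ) : Prop :=
  ∀ (ι : Type u) (e : HilbertBasis ι ℂ 𝓗), HasSum (fun i => ⟪e i, T (e i)⟫_ℂ) t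

/-- Density operators: positive operators of trace one. -/
def IsDensityOperator (ρ : 𝓗 →L[ℂ] 𝓗) : Prop := ρ.IsPositive ∧ HasTrace ρ 1

/-! ### Self-adjoint operators and spectral measures -/

/-- `U† X U` for an (unbounded) operator `X` and a bounded operator `U`. -/
def conj (U : 𝓗 →L[ℂ] 𝓗) (X : 𝓗 →ₗ.[ℂ] 𝓗) : 𝓗 →ₗ.[ℂ] 𝓗 where
  domain := X.domain.comap U.toLinearMap
  toFun := (ContinuousLinearMap.adjoint U).toLinearMap ∘ₗ X.toFun ∘ₗ
    U.toLinearMap.restrict (fun _ hx => hx)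

/-- `X` is affiliated with `M`: `U† X U = X` for every unitary `U` in the commutant of `M`. -/
def IsAffiliated (M : VonNeumannAlgebra 𝓗) (X : 𝓗 →ₗ.[ℂ] 𝓗) : Prop :=
  ∀ U ∈ M.commutant, U ∈ unitary (𝓗 →L[ℂ] 𝓗) → conj U X = X

/-- The observables of the system described by `M`: the self-adjoint operators affiliated
with `M`. -/
def IsObservable (M : VonNeumannAlgebra 𝓗) (X : 𝓗 →ₗ.[ℂ] 𝓗) : Prop :=
  IsSelfAdjoint X ∧ IsAffiliated M X

variable (𝓗) in
/-- Projection-valued measures on the Borel subsets of `ℝ` (the values at non-measurable sets are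
irrelevant); the sums converge strongly. -/
structure SpectralMeasure where
  toFun : Set ℝ → 𝓗 →L[ℂ] 𝓗
  isProj : ∀ Δ, MeasurableSet Δ → IsStarProjection (toFun Δ)
  hasSum : ∀ Δ : ℕ → Set ℝ, (∀ n, MeasurableSet (Δ n)) → Pairwise (Function.onFun Disjoint Δ) →
    (⋃ n, Δ n) = Set.univ → ∀ ψ : 𝓗, HasSum (fun n => toFun (Δ n) ψ) ψ

namespace SpectralMeasure

instance : CoeFun (SpectralMeasure 𝓗) (fun _ => Set ℝ → 𝓗 →L[ℂ] 𝓗) := ⟨toFun⟩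

variable (E : SpectralMeasure 𝓗)

theorem apply_empty (ψ : 𝓗) : E ∅ ψ = 0 := by
  have h := E.hasSum (fun n => if n = 0 then Set.univ else ∅)
    (fun n => by split_ifs <;> simp)
    (fun m n hmn => by
      by_cases hm : m = 0
      · have : n ≠ 0 := fun hn => hmn (hm.trans hn.symm)
        simp [Function.onFun, this]
      · simp [Function.onFun, hm])
    (Set.eq_univ_of_forall fun x => Set.mem_iUnion.2 ⟨0, by simp⟩) ψ
  have h1 := h.summable.tendsto_atTop_zero
  refine tendsto_nhds_unique (tendsto_const_nhds.congr' ?_) h1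
  filter_upwards [Filter.eventually_ne_atTop 0] with n hn
  simp [hn]

theorem hasSum_iUnion {f : ℕ → Set ℝ} (hf : ∀ n, MeasurableSet (f n))
    (hd : Pairwise (Function.onFun Disjoint f)) (ψ : 𝓗) :
    HasSum (fun n => E (f n) ψ) (E (⋃ n, f n) ψ) := by
  -- compare two partitions of the line, both containing the complement of the union
  have key : ∀ g : ℕ → Set ℝ, (∀ n, MeasurableSet (g n)) →
      Pairwise (Function.onFun Disjoint g) →
      HasSum (fun n => E (g n) ψ) (ψ - E (⋃ n, g n)ᶜ ψ) := by
    intro g hg hgd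
    have h := E.hasSum (fun n => Nat.casesOn n (⋃ n, g n)ᶜ g)
      (fun n => by
        cases n with
        | zero => exact (MeasurableSet.iUnion hg).compl
        | succ n => exact hg n)
      (fun m n hmn => by
        cases m with
        | zero =>
          cases n with
          | zero => exact absurd rfl hmn
          | succ n => exact Set.disjoint_compl_left_iff_subset.2 (Set.subset_iUnion g n)
        | succ m =>
          cases n with
          | zero => exact Set.disjoint_compl_right_iff_subset.2 (Set.subset_iUnion g m)
          | succ n => exact hgd (fun h => hmn (congrArg _ h)))
      (Set.eq_univ_of_forall fun x => by
        by_cases hx : x ∈ ⋃ n, g n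
        · obtain ⟨n, hn⟩ := Set.mem_iUnion.1 hx
          exact Set.mem_iUnion.2 ⟨n + 1, hn⟩
        · exact Set.mem_iUnion.2 ⟨0, hx⟩) ψ
    have h2 := (hasSum_nat_add_iff' 1).2 h
    simpa using h2
  have h1 := key f hf hd
  have h2 := key (fun n => if n = 0 then ⋃ n, f n else ∅)
    (fun n => by
      split_ifs
      · exact MeasurableSet.iUnion hf
      · exact MeasurableSet.empty)
    (fun m n hmn => by
      by_cases hm : m = 0
      · have : n ≠ 0 := fun hn => hmn (hm.trans hn.symm)
        simp [Function.onFun, this]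
      · simp [Function.onFun, hm])
  have hu : (⋃ n : ℕ, if n = 0 then ⋃ n, f n else ∅) = ⋃ n, f n := by
    ext x
    simp
  rw [hu] at h2
  have h3 : HasSum (fun n : ℕ => E (if n = 0 then ⋃ n, f n else ∅) ψ) (E (⋃ n, f n) ψ) := by
    have := hasSum_single (f := fun n : ℕ => E (if n = 0 then ⋃ n, f n else ∅) ψ) 0
      (fun n hn => by simp [hn, apply_empty])
    simpa using this
  rw [h3.unique h2]
  exact h1

theorem re_inner_nonneg {Δ : Set ℝ} (hΔ : MeasurableSet Δ) (ψ : 𝓗) :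
    0 ≤ (⟪ψ, E Δ ψ⟫_ℂ).re := by
  have hp := E.isProj Δ hΔ
  have h : E Δ ψ = ContinuousLinearMap.adjoint (E Δ) (E Δ ψ) := by
    rw [← ContinuousLinearMap.star_eq_adjoint, hp.isSelfAdjoint.star_eq,
      ← mul_apply_eq_comp, hp.isIdempotentElem.eq]
  rw [h, ContinuousLinearMap.adjoint_inner_right]
  exact inner_self_nonneg (𝕜 := ℂ)

/-- The measure `Δ ↦ ⟨ψ, E(Δ) ψ⟩`. -/
def scalar (ψ : 𝓗) : Measure ℝ :=
  Measure.ofMeasurable (fun Δ _ => ENNReal.ofReal (⟪ψ, E Δ ψ⟫_ℂ).re)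
    (by simp [apply_empty])
    (fun f hf hd => by
      have h := Complex.hasSum_re ((E.hasSum_iUnion hf hd ψ).mapL (innerSL ℂ ψ))
      simp only [innerSL_apply_apply] at h
      rw [← h.tsum_eq, ENNReal.ofReal_tsum_of_nonneg (fun n => E.re_inner_nonneg (hf n) ψ)
        h.summable])

theorem scalar_apply (ψ : 𝓗) {Δ : Set ℝ} (hΔ : MeasurableSet Δ) :
    E.scalar ψ Δ = ENNReal.ofReal (⟪ψ, E Δ ψ⟫_ℂ).re :=
  Measure.ofMeasurable_apply Δ hΔ

/-- `E` is the spectral measure `E^X` of `X`, i.e. `X = ∫ λ dE(λ)`: the domain of `X` consists of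
the `ψ` with `∫ λ² d⟨ψ, E(λ)ψ⟩ < ∞`, and `⟨ψ, X ψ⟩ = ∫ λ d⟨ψ, E(λ)ψ⟩` for these `ψ`. -/
def IsSpectralMeasureOf (X : 𝓗 →ₗ.[ℂ] 𝓗) : Prop :=
  (∀ ψ : 𝓗, ψ ∈ X.domain ↔ Integrable (fun x : ℝ => x ^ 2) (E.scalar ψ)) ∧
    ∀ ψ : X.domain, ⟪(ψ : 𝓗), X ψ⟫_ℂ = ((∫ x, x ∂(E.scalar ψ) : ℝ) : ℂ)

/-- The range of `E((-∞, r])`, as an element of the logic of closed subspaces. -/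
def family (r : ℝ) : ClosedSubmodule ℂ 𝓗 := (E (Set.Iic r)).range.closure

/-- The real number in `V^(Q)`, `Q` the logic of `𝓗`, that corresponds to the observable with the
spectral measure `E`, namely `{(ř, E((-∞, r])) | r ∈ ℚ}`. -/
def real : QSet.QName.{u, 0} (ClosedSubmodule ℂ 𝓗) := QSet.cut fun r => E.family r

end SpectralMeasure

/-! ### Equality of observables in a state -/

/-- `X =_ρ Y`: the observables `X` and `Y` are equal in the state `ρ`, i.e. `Tr[P ρ] = 1`, where `P`
is the projection-valued truth value `⟦X̃ = Ỹ⟧` of the equality of the real numbers `X̃`, `Ỹ` in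
`V^(Q)` that correspond to `X` and `Y`. -/
def EqualInState (X Y : 𝓗 →ₗ.[ℂ] 𝓗) (ρ : 𝓗 →L[ℂ] 𝓗) : Prop :=
  ∃ E F : SpectralMeasure 𝓗, E.IsSpectralMeasureOf X ∧ F.IsSpectralMeasureOf Y ∧
    HasTrace ((QSet.QName.eqVal E.real F.real).toSubmodule.starProjection ∘L ρ) 1

end Hilbert

/-! ### Composite systems -/

section Composite

variable (H : Type u) [NormedAddCommGroup H] [InnerProductSpace ℂ H]
variable (K : Type v) [NormedAddCommGroup K] [InnerProductSpace ℂ K]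

/-- The tensor product of Hilbert spaces: the completion of the algebraic tensor product. -/
abbrev HTensor : Type (max u v) := UniformSpace.Completion (H ⊗[ℂ] K)

variable {H K}

/-- The vector `x ⊗ y`. -/
def tmul (x : H) (y : K) : HTensor H K := ((x ⊗ₜ[ℂ] y : H ⊗[ℂ] K) : HTensor H K)

/-- The operator `S ⊗ T` for bounded operators `S`, `T`. -/
def tensorOp (S : H →L[ℂ] H) (T : K →L[ℂ] K) : HTensor H K →L[ℂ] HTensor H K :=
  (TensorProduct.mapL S T).completion

/-- `X ⊗ 1` for an (unbounded) operator `X`: its graph is the closed linear span of the pairs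
`(x ⊗ y, X x ⊗ y)`. -/
def ampLeft (X : H →ₗ.[ℂ] H) : HTensor H K →ₗ.[ℂ] HTensor H K :=
  (Submodule.span ℂ {p : HTensor H K × HTensor H K |
    ∃ (x : X.domain) (y : K), p = (tmul (x : H) y, tmul (X x) y)}).topologicalClosure.toLinearPMap

/-- `1 ⊗ Y` for an (unbounded) operator `Y`: its graph is the closed linear span of the pairs
`(x ⊗ y, x ⊗ Y y)`. -/
def ampRight (Y : K →ₗ.[ℂ] K) : HTensor H K →ₗ.[ℂ] HTensor H K :=
  (Submodule.span ℂ {p : HTensor H K × HTensor H K |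
    ∃ (x : H) (y : Y.domain), p = (tmul x (y : K), tmul x (Y y))}).topologicalClosure.toLinearPMap

variable [CompleteSpace H] [CompleteSpace K]

/-- `R = Tr_K[T]`, the partial trace over `K`: `⟨ξ, R η⟩ = ∑ⱼ ⟨ξ ⊗ fⱼ, T (η ⊗ fⱼ)⟩` for all `ξ`, `η`
and every orthonormal basis `(fⱼ)` of `K`. -/
def IsPartialTrace (T : HTensor H K →L[ℂ] HTensor H K) (R : H →L[ℂ] H) : Prop :=
  ∀ (ξ η : H) (ι : Type v) (f : HilbertBasis ι ℂ K),
    HasSum (fun j => ⟪tmul ξ (f j), T (tmul η (f j))⟫_ℂ) ⟪ξ, R η⟫_ℂ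

variable (K) in
/-- Measuring processes `(K, σ, U, meter)` for `M`: `σ` is a density operator on `K`, `U` a unitary
operator on `H ⊗ K`, `meter` a self-adjoint operator on `K`, and
`Tr_K[U†(X ⊗ E(Δ))U(1 ⊗ σ)] ∈ M` for all `X ∈ M` and all Borel sets `Δ`, where `E` is the spectral
measure of `meter`. -/
structure MeasuringProcess (M : VonNeumannAlgebra H) where
  σ : K →L[ℂ] K
  isDensity : IsDensityOperator σ
  U : HTensor H K →L[ℂ] HTensor H K
  isUnitary : U ∈ unitary (HTensor H K →L[ℂ] HTensor H K)
  meter : K →ₗ.[ℂ] K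
  isSelfAdjoint : IsSelfAdjoint meter
  partialTrace_mem : ∀ E : SpectralMeasure K, E.IsSpectralMeasureOf meter →
    ∀ X ∈ M, ∀ Δ : Set ℝ, MeasurableSet Δ →
      ∃ R ∈ M, IsPartialTrace
        (ContinuousLinearMap.adjoint U ∘L tensorOp X (E Δ) ∘L U ∘L tensorOp 1 σ) R

namespace MeasuringProcess

variable {M : VonNeumannAlgebra H} (P : MeasuringProcess K M)

/-- The meter observable after the measuring interaction, `U†(1 ⊗ meter)U`. -/
def meterAfter : HTensor H K →ₗ.[ℂ] HTensor H K := conj P.U (ampRight P.meter)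

/-- `povm` is the POVM `Π` of the measuring process: `Π(Δ) = Tr_K[F(Δ)(1 ⊗ σ)]` for all Borel sets `Δ`,
where `F` is the spectral measure of the meter observable after the interaction. -/
def IsPOVM (povm : Set ℝ → H →L[ℂ] H) : Prop :=
  ∃ F : SpectralMeasure (HTensor H K), F.IsSpectralMeasureOf P.meterAfter ∧
    ∀ Δ : Set ℝ, MeasurableSet Δ → IsPartialTrace (F Δ ∘L tensorOp 1 P.σ) (povm Δ)

/-- The measuring process measures `A` in `ρ`: the observable `A ⊗ 1` before the interaction and the
meter observable after the interaction are equal in the state `ρ ⊗ σ`. -/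
def Measures (A : H →ₗ.[ℂ] H) (ρ : H →L[ℂ] H) : Prop :=
  EqualInState (ampLeft A) P.meterAfter (tensorOp ρ P.σ)

end MeasuringProcess

end Composite

end QMeas

end

/-! The set-theoretic equality reduces to an equality of vectors. Check names of distinct rationals
are equal with truth value `⊥`, so `⟦X̃ = Ỹ⟧` is the meet over rational `r` of the two Sasaki
implications between the spectral projections at `r`. A vector `ψ` lies in it exactly when `E^X((-∞,
r]) ψ = E^Y((-∞, r]) ψ` for all `r` (`SpectralMeasure.mem_eqVal_iff`). A projection has probability
one in `τ` exactly when it contains the range of `τ` (`hasTrace_starProjection_comp_iff`). Hence `X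
=_τ Y` says that the two spectral measures agree on the range of `τ` (`equalInState_iff`).

Let `E = E^A` and let `F` be the spectral measure of the meter after the interaction. Pure states
`ρ` show that measuring `A` in every state amounts to `F(Δ)(x ⊗ σy) = E(Δ)x ⊗ σy` for all `x`, `y`.
Taking the partial trace, with `Tr σ = 1`, gives `Π(Δ) = E(Δ)`. Conversely, let `Π = E`. If `E(Δ)φ =
0`, then `F(Δ)` has trace zero against the positive operator `|φ⟩⟨φ| ⊗ σ`, which forces `F(Δ)(φ ⊗
σy) = 0` (`apply_tmul_eq_zero`). With `φ = E(Δᶜ)x` for `Δ`, and `φ = E(Δ)x` for `Δᶜ`, this returns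
the displayed identity.

Two facts about unbounded operators support this. A spectral measure, characterized only by the
domain and the quadratic form, is unique (`apply_Iic_eq`): spectral subspaces of two candidates for
separated sets are orthogonal by a contraction estimate. And `E ⊗ 1` is the spectral measure of `A ⊗
1` (`IsSpectralMeasureOf.amp`), which is reached through the bounded truncations `A E([-n, n])`. -/

namespace QMeas

universe u v

/-! ### Calculus of projection-valued measures. -/

namespace SpectralMeasure

variable {𝓗 : Type u} [NormedAddCommGroup 𝓗] [InnerProductSpace ℂ 𝓗] [CompleteSpace 𝓗]
variable (E : SpectralMeasure 𝓗) {S T : Set ℝ}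

theorem empty_eq : E ∅ = 0 := by
  ext ψ
  simp [E.apply_empty]

theorem univ_eq : E Set.univ = 1 := by
  ext ψ
  have h := E.hasSum (fun n => if n = 0 then Set.univ else ∅)
    (fun n => by split_ifs <;> simp)
    (fun m n hmn => by
      by_cases hm : m = 0
      · have : n ≠ 0 := fun hn => hmn (hm.trans hn.symm)
        simp [Function.onFun, this]
      · simp [Function.onFun, hm])
    (Set.eq_univ_of_forall fun x => Set.mem_iUnion.2 ⟨0, by simp⟩) ψ
  have h2 := hasSum_single (f := fun n : ℕ => E (if n = 0 then Set.univ else ∅) ψ) 0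
    (fun n hn => by simp [hn, apply_empty])
  simpa using h2.unique h

theorem union_eq (hS : MeasurableSet S) (hT : MeasurableSet T) (hd : Disjoint S T) :
    E (S ∪ T) = E S + E T := by
  ext ψ
  have h := E.hasSum_iUnion (f := fun n => if n = 0 then S else if n = 1 then T else ∅)
    (fun n => by split_ifs <;> simp [*])
    (fun m n hmn => by
      rcases m with _ | _ | m <;> rcases n with _ | _ | n <;>
        simp_all [Function.onFun, disjoint_comm]) ψ
  have hu : (⋃ n : ℕ, if n = 0 then S else if n = 1 then T else ∅) = S ∪ T := by
    ext x
    simp only [Set.mem_iUnion, Set.mem_union]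
    constructor
    · rintro ⟨n, hn⟩
      split_ifs at hn
      · exact Or.inl hn
      · exact Or.inr hn
      · exact hn.elim
    · rintro (hx | hx)
      · exact ⟨0, by simpa using hx⟩
      · exact ⟨1, by simpa using hx⟩
  rw [hu] at h
  have h2 : HasSum _ _ (.unconditional ℕ) := hasSum_sum_of_ne_finset_zero
    (f := fun n : ℕ => E (if n = 0 then S else if n = 1 then T else ∅) ψ) (s := {0, 1})
    (fun n hn => by
      simp only [Finset.mem_insert, Finset.mem_singleton, not_or] at hn
      simp [hn.1, hn.2, apply_empty])
  have := h.unique h2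
  simpa using this

theorem compl_eq (hS : MeasurableSet S) : E Sᶜ = 1 - E S := by
  rw [eq_sub_iff_add_eq, ← E.union_eq hS.compl hS disjoint_compl_left, Set.compl_union_self,
    E.univ_eq]

/-- Additivity makes the sum of the two idempotents idempotent, so they anticommute; anticommuting
idempotents have product zero. -/
theorem mul_eq_zero (hS : MeasurableSet S) (hT : MeasurableSet T) (hd : Disjoint S T) :
    E S * E T = 0 := by
  have h := (E.isProj _ (hS.union hT)).isIdempotentElem
  rw [E.union_eq hS hT hd, IsIdempotentElem.add_iff (E.isProj S hS).isIdempotentElem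
    (E.isProj T hT).isIdempotentElem] at h
  -- Passing from anticommutation to a zero product cancels a factor two, hence torsion-freeness.
  let : Module ℚ (𝓗 →L[ℂ] 𝓗) := Module.compHom _ (algebraMap ℚ ℂ)
  have : IsAddTorsionFree (𝓗 →L[ℂ] 𝓗) := .of_module_rat _
  exact (E.isProj S hS).isIdempotentElem.mul_eq_zero_of_anticommute h

theorem mul_eq (hS : MeasurableSet S) (hT : MeasurableSet T) : E S * E T = E (S ∩ T) := by
  have h1 : E S = E (S ∩ T) + E (S \ T) := by
    rw [← E.union_eq (hS.inter hT) (hS.diff hT)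
      (Set.disjoint_sdiff_right.mono_left Set.inter_subset_right), Set.inter_union_sdiff]
  have h2 : E T = E (S ∩ T) + E (T \ S) := by
    rw [← E.union_eq (hS.inter hT) (hT.diff hS)
      (Set.disjoint_sdiff_right.mono_left Set.inter_subset_left), Set.inter_comm,
      Set.inter_union_sdiff]
  have h3 : E (S \ T) * E T = 0 := E.mul_eq_zero (hS.diff hT) hT Set.disjoint_sdiff_left
  have h4 : E (S ∩ T) * E (T \ S) = 0 := E.mul_eq_zero (hS.inter hT) (hT.diff hS)
    (Set.disjoint_sdiff_right.mono_left Set.inter_subset_left)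
  rw [h1, add_mul, h3, add_zero, h2, mul_add, h4, add_zero]
  exact (E.isProj _ (hS.inter hT)).isIdempotentElem

theorem apply_apply (hS : MeasurableSet S) (hT : MeasurableSet T) (ψ : 𝓗) :
    E S (E T ψ) = E (S ∩ T) ψ := by
  rw [← E.mul_eq hS hT, mul_apply_eq_comp]

theorem apply_apply_of_subset (hS : MeasurableSet S) (hT : MeasurableSet T) (h : S ⊆ T) (ψ : 𝓗) :
    E S (E T ψ) = E S ψ := by
  rw [E.apply_apply hS hT, Set.inter_eq_left.2 h]

theorem apply_self (hS : MeasurableSet S) (ψ : 𝓗) : E S (E S ψ) = E S ψ :=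
  E.apply_apply_of_subset hS hS subset_rfl ψ

theorem inner_apply_left (hS : MeasurableSet S) (φ ψ : 𝓗) : ⟪E S φ, ψ⟫_ℂ = ⟪φ, E S ψ⟫_ℂ := by
  conv_lhs => rw [← (E.isProj S hS).isSelfAdjoint.star_eq, ContinuousLinearMap.star_eq_adjoint,
    ContinuousLinearMap.adjoint_inner_left]

theorem inner_self_apply (hS : MeasurableSet S) (ψ : 𝓗) :
    ⟪ψ, E S ψ⟫_ℂ = ((‖E S ψ‖ ^ 2 : ℝ) : ℂ) := by
  rw [← E.apply_self hS, ← E.inner_apply_left hS, inner_self_eq_norm_sq_to_K, E.apply_self hS]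
  simp

theorem norm_apply_le (hS : MeasurableSet S) (ψ : 𝓗) : ‖E S ψ‖ ≤ ‖ψ‖ := by
  have h := norm_inner_le_norm (𝕜 := ℂ) ψ (E S ψ)
  rw [E.inner_self_apply hS, Complex.norm_real, Real.norm_of_nonneg (by positivity), sq] at h
  rcases (norm_nonneg (E S ψ)).eq_or_lt with h0 | h0
  · rw [← h0]
    positivity
  · exact le_of_mul_le_mul_right h h0

theorem scalar_eq (hS : MeasurableSet S) (ψ : 𝓗) :
    E.scalar ψ S = ENNReal.ofReal (‖E S ψ‖ ^ 2) := by
  rw [E.scalar_apply ψ hS, E.inner_self_apply hS, Complex.ofReal_re]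

theorem scalar_real (hS : MeasurableSet S) (ψ : 𝓗) : (E.scalar ψ).real S = ‖E S ψ‖ ^ 2 := by
  rw [measureReal_def, E.scalar_eq hS, ENNReal.toReal_ofReal (by positivity)]

instance (ψ : 𝓗) : IsFiniteMeasure (E.scalar ψ) :=
  ⟨by rw [E.scalar_eq MeasurableSet.univ]; exact ENNReal.ofReal_lt_top⟩

theorem scalar_restrict (hS : MeasurableSet S) (ψ : 𝓗) :
    E.scalar (E S ψ) = (E.scalar ψ).restrict S := by
  ext T hT
  rw [Measure.restrict_apply hT, E.scalar_eq hT, E.scalar_eq (hT.inter hS), E.apply_apply hT hS]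

theorem norm_sub_sq (hS : MeasurableSet S) (hT : MeasurableSet T) (h : S ⊆ T) (ψ : 𝓗) :
    ‖E T ψ - E S ψ‖ ^ 2 = ‖E T ψ‖ ^ 2 - ‖E S ψ‖ ^ 2 := by
  have h1 : E T ψ - E S ψ = E (T \ S) ψ := by
    rw [sub_eq_iff_eq_add, add_comm, ← add_apply,
      ← E.union_eq hS (hT.diff hS) Set.disjoint_sdiff_right, Set.union_sdiff_cancel h]
  rw [h1, ← E.scalar_real (hT.diff hS), ← E.scalar_real hS, ← E.scalar_real hT,
    measureReal_sdiff h hS]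

/-- By Pythagoras the squared distance to the limit is a difference of masses of the scalar measure,
so continuity of measures from below gives strong convergence. -/
theorem tendsto_apply_iUnion {s : ℕ → Set ℝ} (hs : ∀ n, MeasurableSet (s n)) (hm : Monotone s)
    (ψ : 𝓗) : Filter.Tendsto (fun n => E (s n) ψ) Filter.atTop (nhds (E (⋃ n, s n) ψ)) := by
  have hU := MeasurableSet.iUnion hs
  have h1 : Filter.Tendsto (fun n => (E.scalar ψ).real (s n)) Filter.atTop
      (nhds ((E.scalar ψ).real (⋃ n, s n))) :=
    (ENNReal.tendsto_toReal (measure_ne_top _ _)).comp (tendsto_measure_iUnion_atTop hm)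
  simp only [E.scalar_real (hs _), E.scalar_real hU] at h1
  rw [tendsto_iff_norm_sub_tendsto_zero]
  have h2 : Filter.Tendsto (fun n => ‖E (s n) ψ - E (⋃ n, s n) ψ‖ ^ 2) Filter.atTop (nhds 0) := by
    have := (tendsto_const_nhds (x := ‖E (⋃ n, s n) ψ‖ ^ 2)).sub h1
    rw [sub_self] at this
    refine this.congr fun n => ?_
    rw [norm_sub_rev, E.norm_sub_sq (hs n) hU (Set.subset_iUnion s n)]
  simpa using h2.sqrt

theorem iUnion_Icc_nat : (⋃ n : ℕ, Set.Icc (-(n : ℝ)) n) = Set.univ := by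
  refine Set.eq_univ_of_forall fun x => Set.mem_iUnion.2 ?_
  obtain ⟨n, hn⟩ := exists_nat_ge |x|
  exact ⟨n, abs_le.1 hn⟩

theorem monotone_Icc_nat : Monotone fun n : ℕ => Set.Icc (-(n : ℝ)) n := fun _ _ h =>
  Set.Icc_subset_Icc (neg_le_neg (Nat.cast_le.2 h)) (Nat.cast_le.2 h)

theorem tendsto_apply_Icc (ψ : 𝓗) :
    Filter.Tendsto (fun n : ℕ => E (Set.Icc (-(n : ℝ)) n) ψ) Filter.atTop (nhds ψ) := by
  have h := E.tendsto_apply_iUnion (fun n : ℕ => measurableSet_Icc) monotone_Icc_nat ψ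
  rwa [iUnion_Icc_nat, E.univ_eq, one_apply_eq_self] at h

/-- Two spectral measures that agree at `ψ` on the rational half-lines agree at `ψ`. -/
theorem apply_eq_of_forall_Iic {E F : SpectralMeasure 𝓗} {ψ : 𝓗}
    (h : ∀ r : ℚ, E (Set.Iic (r : ℝ)) ψ = F (Set.Iic (r : ℝ)) ψ) {S : Set ℝ}
    (hS : MeasurableSet S) : E S ψ = F S ψ := by
  induction S, hS using MeasurableSpace.induction_on_inter Real.borel_eq_generateFrom_Iic_rat
    Real.isPiSystem_Iic_rat with
  | empty => rw [E.empty_eq, F.empty_eq]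
  | basic t ht =>
    obtain ⟨r, hr⟩ := Set.mem_iUnion.1 ht
    rw [Set.mem_singleton_iff.1 hr]
    exact h r
  | compl t htm ih =>
    rw [E.compl_eq htm, F.compl_eq htm, sub_apply, sub_apply, ih]
  | iUnion f hd hf ih =>
    have h1 := E.hasSum_iUnion hf hd ψ
    simp only [ih] at h1
    exact h1.unique (F.hasSum_iUnion hf hd ψ)

end SpectralMeasure

/-! ### Symmetric operators and their quadratic forms. -/

section Symmetric

variable {V : Type u} [NormedAddCommGroup V] [InnerProductSpace ℂ V]

/-- The numerical radius of a symmetric operator bounds its norm. -/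
theorem norm_le_of_isSymmetric {T : V →ₗ[ℂ] V} (hT : T.IsSymmetric) {c : ℝ} (hc : 0 ≤ c)
    (h : ∀ x, |(⟪x, T x⟫_ℂ).re| ≤ c * ‖x‖ ^ 2) (x : V) : ‖T x‖ ≤ c * ‖x‖ := by
  -- Subtracting the bounds at `φ + ψ` and `φ - ψ` cancels the diagonal terms; the parallelogram law
  -- evaluates the right-hand side.
  have polar : ∀ φ ψ : V, 2 * (⟪φ, T ψ⟫_ℂ).re ≤ c * (‖φ‖ ^ 2 + ‖ψ‖ ^ 2) := by
    intro φ ψ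
    have h1 := (abs_le.1 (h (φ + ψ))).2
    have h2 := (abs_le.1 (h (φ - ψ))).1
    have h3 : (⟪ψ, T φ⟫_ℂ).re = (⟪φ, T ψ⟫_ℂ).re := by
      rw [← hT ψ φ, ← inner_conj_symm, Complex.conj_re]
    have h4 := parallelogram_law_with_norm ℂ φ ψ
    simp only [map_add, map_sub, inner_add_left, inner_add_right, inner_sub_left, inner_sub_right,
      Complex.add_re, Complex.sub_re] at h1 h2
    nlinarith
  -- The test vector is `φ = d⁻¹ T x`. Since `c` may be zero, a positive `d ≥ c` is used first and
  -- then `d` decreases to `c`.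
  have key : ∀ d : ℝ, 0 < d → c ≤ d → ‖T x‖ ≤ d * ‖x‖ := by
    intro d hd hcd
    have h1 := polar ((d⁻¹ : ℝ) • T x) x
    have h2 : ⟪(d⁻¹ : ℝ) • T x, T x⟫_ℂ = ((d⁻¹ * ‖T x‖ ^ 2 : ℝ) : ℂ) := by
      rw [← Complex.coe_smul, inner_smul_left, inner_self_eq_norm_sq_to_K]
      simp
    rw [h2, Complex.ofReal_re, norm_smul, Real.norm_of_nonneg (by positivity), mul_pow] at h1
    have h3 : c * (d⁻¹ ^ 2 * ‖T x‖ ^ 2 + ‖x‖ ^ 2) ≤ d * (d⁻¹ ^ 2 * ‖T x‖ ^ 2 + ‖x‖ ^ 2) := by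
      gcongr
    have h4 : d * (d⁻¹ ^ 2 * ‖T x‖ ^ 2 + ‖x‖ ^ 2) = d⁻¹ * ‖T x‖ ^ 2 + d * ‖x‖ ^ 2 := by
      field_simp
    have h5 : d⁻¹ * ‖T x‖ ^ 2 ≤ d * ‖x‖ ^ 2 := by linarith
    have h6 : ‖T x‖ ^ 2 ≤ (d * ‖x‖) ^ 2 := by
      calc ‖T x‖ ^ 2 = d * (d⁻¹ * ‖T x‖ ^ 2) := by field_simp
        _ ≤ d * (d * ‖x‖ ^ 2) := by gcongr
        _ = _ := by ring
    exact le_of_sq_le_sq h6 (by positivity)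
  refine ge_of_tendsto (x := nhdsWithin c (Set.Ioi c)) (f := fun d : ℝ => d * ‖x‖) ?_ ?_
  · exact ((continuous_id.mul continuous_const).tendsto c).mono_left nhdsWithin_le_nhds
  · filter_upwards [self_mem_nhdsWithin] with d hd
    exact key d (hc.trans_lt hd) (le_of_lt hd)

/-- An operator with a real quadratic form is symmetric. -/
theorem inner_map_eq_of_im_eq_zero {X : V →ₗ.[ℂ] V}
    (h : ∀ ψ : X.domain, (⟪(ψ : V), X ψ⟫_ℂ).im = 0) (φ ψ : X.domain) :
    ⟪X φ, (ψ : V)⟫_ℂ = ⟪(φ : V), X ψ⟫_ℂ := by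
  -- The vectors `φ + ψ` and `φ + iψ` yield the imaginary and the real part of the polarized
  -- identity.
  have h1 := h (φ + ψ)
  have h2 := h (φ + Complex.I • ψ)
  have h3 := h φ
  have h4 := h ψ
  simp only [LinearPMap.map_add, LinearPMap.map_smul, Submodule.coe_add, Submodule.coe_smul,
    inner_add_left, inner_add_right, inner_smul_left, inner_smul_right, Complex.add_im,
    Complex.add_re, Complex.mul_im, Complex.mul_re, Complex.conj_I, Complex.neg_re,
    Complex.neg_im, Complex.I_re, Complex.I_im, h3, h4] at h1 h2
  rw [← inner_conj_symm]
  apply Complex.ext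
  · rw [Complex.conj_re]
    linarith
  · rw [Complex.conj_im]
    linarith

end Symmetric

/-! ### Commutation with, and uniqueness of, the spectral measure of an operator. -/

namespace SpectralMeasure

variable {𝓗 : Type u} [NormedAddCommGroup 𝓗] [InnerProductSpace ℂ 𝓗] [CompleteSpace 𝓗]
variable {E F : SpectralMeasure 𝓗} {S T : Set ℝ}

theorem integrable_id_of_sq {μ : Measure ℝ} [IsFiniteMeasure μ]
    (h : Integrable (fun x : ℝ => x ^ 2) μ) : Integrable (fun x : ℝ => x) μ := by
  refine (h.add (integrable_const (1 : ℝ))).mono' measurable_id.aestronglyMeasurable ?_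
  refine Filter.Eventually.of_forall fun x => ?_
  rw [Real.norm_eq_abs, abs_le]
  simp only [Pi.add_apply]
  constructor <;> nlinarith [sq_nonneg (x - 1), sq_nonneg (x + 1), sq_nonneg x]

namespace IsSpectralMeasureOf

variable {X : 𝓗 →ₗ.[ℂ] 𝓗} (hE : E.IsSpectralMeasureOf X)

include hE

theorem apply_mem_domain (hS : MeasurableSet S) {ψ : 𝓗} (h : ψ ∈ X.domain) : E S ψ ∈ X.domain := by
  rw [hE.1, E.scalar_restrict hS]
  exact ((hE.1 ψ).1 h).restrict

theorem apply_mem_domain_of_subset_Icc (hS : MeasurableSet S) {a b : ℝ} (hb : S ⊆ Set.Icc a b)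
    (ψ : 𝓗) : E S ψ ∈ X.domain := by
  rw [hE.1, E.scalar_restrict hS]
  refine Integrable.of_bound (by fun_prop) (max |a| |b| ^ 2) ?_
  filter_upwards [ae_restrict_mem hS] with x hx
  rw [norm_pow]
  gcongr
  exact abs_le_max_abs_abs (hb hx).1 (hb hx).2

theorem inner_map (φ ψ : X.domain) : ⟪X φ, (ψ : 𝓗)⟫_ℂ = ⟪(φ : 𝓗), X ψ⟫_ℂ :=
  inner_map_eq_of_im_eq_zero (fun ψ => by rw [hE.2 ψ, Complex.ofReal_im]) φ ψ

theorem dense_domain : Dense (X.domain : Set 𝓗) := fun ψ =>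
  mem_closure_of_tendsto (E.tendsto_apply_Icc ψ) (Filter.Eventually.of_forall fun _ =>
    hE.apply_mem_domain_of_subset_Icc measurableSet_Icc subset_rfl ψ)

theorem integrable_id (ψ : X.domain) : Integrable (fun x : ℝ => x) (E.scalar ψ) :=
  integrable_id_of_sq ((hE.1 ψ).1 ψ.2)

/-- The form of `X` is an integral, which splits over `S` and `Sᶜ`. So for `α` in the range of
`E(S)` and `β` in that of `E(Sᶜ)` the form is additive at `α + β`, and the cross terms, equal by
symmetry, vanish. -/
theorem re_inner_apply_apply_compl (hS : MeasurableSet S) (φ χ : X.domain) :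
    (⟪E S φ, X ⟨E Sᶜ χ, hE.apply_mem_domain hS.compl χ.2⟩⟫_ℂ).re = 0 := by
  set α : X.domain := ⟨E S φ, hE.apply_mem_domain hS φ.2⟩ with hα
  set β : X.domain := ⟨E Sᶜ χ, hE.apply_mem_domain hS.compl χ.2⟩ with hβ
  have h1 : E S (α + β : X.domain) = α := by
    simp [hα, hβ, E.apply_self hS, E.apply_apply hS hS.compl, E.empty_eq]
  have h2 : E Sᶜ (α + β : X.domain) = β := by
    simp [hα, hβ, E.apply_self hS.compl, E.apply_apply hS.compl hS, E.empty_eq]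
  have h3 := integral_add_compl hS (hE.integrable_id (α + β))
  rw [← E.scalar_restrict hS, ← E.scalar_restrict hS.compl, h1, h2] at h3
  have h4 := congrArg Complex.re (hE.2 (α + β))
  have h5 := congrArg Complex.re (hE.2 α)
  have h6 := congrArg Complex.re (hE.2 β)
  have h7 : (⟪(β : 𝓗), X α⟫_ℂ).re = (⟪(α : 𝓗), X β⟫_ℂ).re := by
    rw [← hE.inner_map β α, ← inner_conj_symm, Complex.conj_re]
  rw [Complex.ofReal_re] at h4 h5 h6
  simp only [LinearPMap.map_add, Submodule.coe_add, inner_add_left, inner_add_right,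
    Complex.add_re] at h4
  change (⟪(α : 𝓗), X β⟫_ℂ).re = 0
  simp only [Submodule.coe_add] at h3
  linarith

/-- Replacing `φ` by `iφ` turns the vanishing real part into a vanishing imaginary part; the domain
is dense. -/
theorem apply_map_apply_compl (hS : MeasurableSet S) (χ : X.domain) :
    E S (X ⟨E Sᶜ χ, hE.apply_mem_domain hS.compl χ.2⟩) = 0 := by
  refine hE.dense_domain.eq_zero_of_inner_right ℂ fun φ' hφ => ?_
  let φ : X.domain := ⟨φ', hφ⟩
  change ⟪(φ : 𝓗), _⟫_ℂ = 0
  rw [← E.inner_apply_left hS]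
  have h1 := hE.re_inner_apply_apply_compl hS φ χ
  have h2 := hE.re_inner_apply_apply_compl hS (Complex.I • φ) χ
  simp only [Submodule.coe_smul, map_smul, inner_smul_left, Complex.conj_I, Complex.mul_re,
    Complex.neg_re, Complex.neg_im, Complex.I_re, Complex.I_im] at h2
  apply Complex.ext
  · exact h1
  · rw [Complex.zero_im]
    linarith

/-- An operator commutes with its spectral measure. -/
theorem map_apply (hS : MeasurableSet S) (ψ : X.domain) :
    X ⟨E S ψ, hE.apply_mem_domain hS ψ.2⟩ = E S (X ψ) := by
  have h1 : ψ = ⟨E S ψ, hE.apply_mem_domain hS ψ.2⟩ +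
      (⟨E Sᶜ ψ, hE.apply_mem_domain hS.compl ψ.2⟩ : X.domain) := by
    ext
    simp [E.compl_eq hS]
  have h2 : E Sᶜ (X ⟨E S ψ, hE.apply_mem_domain hS ψ.2⟩) = 0 := by
    have := hE.apply_map_apply_compl hS.compl ψ
    simpa only [compl_compl] using this
  rw [E.compl_eq hS, sub_apply, one_apply_eq_self, sub_eq_zero] at h2
  conv_rhs => rw [h1, LinearPMap.map_add, map_add, hE.apply_map_apply_compl hS, add_zero]
  exact h2

theorem le_re_inner_map (hS : MeasurableSet S) {a : ℝ} (ha : S ⊆ Set.Ici a) (ψ : X.domain)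
    (h : E S ψ = ψ) : a * ‖(ψ : 𝓗)‖ ^ 2 ≤ (⟪(ψ : 𝓗), X ψ⟫_ℂ).re := by
  rw [hE.2 ψ, Complex.ofReal_re]
  have h1 : a * ‖(ψ : 𝓗)‖ ^ 2 = ∫ _, a ∂(E.scalar ψ) := by
    rw [integral_const, E.scalar_real MeasurableSet.univ, E.univ_eq, smul_eq_mul, mul_comm]
    rfl
  rw [h1]
  refine integral_mono_ae (integrable_const a) (hE.integrable_id ψ) ?_
  rw [← h, E.scalar_restrict hS]
  filter_upwards [ae_restrict_mem hS] with x hx using ha hx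

theorem re_inner_map_le (hS : MeasurableSet S) {b : ℝ} (hb : S ⊆ Set.Iic b) (ψ : X.domain)
    (h : E S ψ = ψ) : (⟪(ψ : 𝓗), X ψ⟫_ℂ).re ≤ b * ‖(ψ : 𝓗)‖ ^ 2 := by
  rw [hE.2 ψ, Complex.ofReal_re]
  have h1 : b * ‖(ψ : 𝓗)‖ ^ 2 = ∫ _, b ∂(E.scalar ψ) := by
    rw [integral_const, E.scalar_real MeasurableSet.univ, E.univ_eq, smul_eq_mul, mul_comm]
    rfl
  rw [h1]
  refine integral_mono_ae (hE.integrable_id ψ) (integrable_const b) ?_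
  rw [← h, E.scalar_restrict hS]
  filter_upwards [ae_restrict_mem hS] with x hx using hb hx

omit hE in
/-- The everywhere defined operator `X E(S)`, for bounded `S`. -/
def truncLin (hE : E.IsSpectralMeasureOf X) (hS : MeasurableSet S) {a b : ℝ}
    (hb : S ⊆ Set.Icc a b) : 𝓗 →ₗ[ℂ] 𝓗 :=
  X.toFun ∘ₗ (E S).toLinearMap.codRestrict X.domain (hE.apply_mem_domain_of_subset_Icc hS hb)

theorem truncLin_apply (hS : MeasurableSet S) {a b : ℝ} (hb : S ⊆ Set.Icc a b) (ψ : 𝓗) :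
    hE.truncLin hS hb ψ = X ⟨E S ψ, hE.apply_mem_domain_of_subset_Icc hS hb ψ⟩ := rfl

theorem truncLin_apply_apply (hS : MeasurableSet S) {a b : ℝ} (hb : S ⊆ Set.Icc a b)
    (hT : MeasurableSet T) (ψ : 𝓗) : hE.truncLin hS hb (E T ψ) = E T (hE.truncLin hS hb ψ) := by
  rw [truncLin_apply, truncLin_apply, ← hE.map_apply hT]
  congr 2
  change E S (E T ψ) = E T (E S ψ)
  rw [E.apply_apply hS hT, E.apply_apply hT hS, Set.inter_comm]

theorem truncLin_apply_self (hS : MeasurableSet S) {a b : ℝ} (hb : S ⊆ Set.Icc a b) (ψ : 𝓗) :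
    hE.truncLin hS hb (E S ψ) = hE.truncLin hS hb ψ := by
  rw [truncLin_apply, truncLin_apply]
  congr 2
  exact E.apply_self hS ψ

theorem inner_truncLin (hS : MeasurableSet S) {a b : ℝ} (hb : S ⊆ Set.Icc a b) (φ ψ : 𝓗) :
    ⟪φ, hE.truncLin hS hb ψ⟫_ℂ =
      ⟪E S φ, X ⟨E S ψ, hE.apply_mem_domain_of_subset_Icc hS hb ψ⟩⟫_ℂ := by
  rw [← hE.truncLin_apply_self hS hb ψ, hE.truncLin_apply_apply hS hb hS, ← E.inner_apply_left hS,
    truncLin_apply]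

theorem isSymmetric_truncLin (hS : MeasurableSet S) {a b : ℝ} (hb : S ⊆ Set.Icc a b) :
    (hE.truncLin hS hb).IsSymmetric := fun φ ψ => by
  rw [← inner_conj_symm, hE.inner_truncLin hS hb, hE.inner_truncLin hS hb, inner_conj_symm]
  exact hE.inner_map ⟨E S φ, hE.apply_mem_domain_of_subset_Icc hS hb φ⟩
    ⟨E S ψ, hE.apply_mem_domain_of_subset_Icc hS hb ψ⟩

/-- On the range of `E(S)` the form of `X` lies between `c - R` and `c + R`, so the symmetric
operator `X E(S) - c E(S)` has numerical radius at most `R`. -/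
theorem norm_truncLin_sub_le (hS : MeasurableSet S) {c R : ℝ} (hR : 0 ≤ R)
    (hb : S ⊆ Set.Icc (c - R) (c + R)) (ψ : 𝓗) :
    ‖hE.truncLin hS hb ψ - (c : ℂ) • E S ψ‖ ≤ R * ‖ψ‖ := by
  have hsymm : (hE.truncLin hS hb - (c : ℂ) • (E S).toLinearMap).IsSymmetric := by
    refine (hE.isSymmetric_truncLin hS hb).sub fun φ ψ => ?_
    change ⟪(c : ℂ) • E S φ, ψ⟫_ℂ = ⟪φ, (c : ℂ) • E S ψ⟫_ℂ
    rw [inner_smul_left, inner_smul_right, Complex.conj_ofReal, E.inner_apply_left hS]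
  refine norm_le_of_isSymmetric hsymm hR (fun x => ?_) ψ
  set y : X.domain := ⟨E S x, hE.apply_mem_domain_of_subset_Icc hS hb x⟩ with hy
  have h1 := hE.le_re_inner_map hS (fun t ht => (hb ht).1) y (E.apply_self hS x)
  have h2 := hE.re_inner_map_le hS (fun t ht => (hb ht).2) y (E.apply_self hS x)
  have h3 : R * ‖E S x‖ ^ 2 ≤ R * ‖x‖ ^ 2 := by
    gcongr
    exact E.norm_apply_le hS x
  have h4 : (⟪x, (hE.truncLin hS hb - (c : ℂ) • (E S).toLinearMap) x⟫_ℂ).re =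
      (⟪(y : 𝓗), X y⟫_ℂ).re - c * ‖(y : 𝓗)‖ ^ 2 := by
    rw [LinearMap.sub_apply, inner_sub_right, Complex.sub_re, hE.inner_truncLin hS hb]
    congr 1
    simp only [LinearMap.smul_apply, ContinuousLinearMap.coe_coe, inner_smul_right,
      E.inner_self_apply hS]
    rw [← Complex.ofReal_mul, Complex.ofReal_re]
  rw [h4, abs_le]
  change _ ≤ _ at h3
  have h5 : ‖(y : 𝓗)‖ = ‖E S x‖ := rfl
  rw [h5] at *
  constructor <;> linarith

/-- Spectral subspaces of two spectral measures of one operator, for separated sets, are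
orthogonal. -/
theorem mul_eq_zero_of_lt (hF : F.IsSpectralMeasureOf X) {c R R' : ℝ} (hR : 0 ≤ R) (hRR' : R < R') :
    F (Set.Ici (c + R')) * E (Set.Icc (c - R) (c + R)) = 0 := by
  set P := E (Set.Icc (c - R) (c + R)) with hP
  set Q := F (Set.Ici (c + R')) with hQ
  have hR' : 0 < R' := hR.trans_lt hRR'
  have hS : MeasurableSet (Set.Icc (c - R) (c + R)) := measurableSet_Icc
  have hT : MeasurableSet (Set.Ici (c + R')) := measurableSet_Ici
  -- Put `p = Px` and `q = Qp`. Both projections commute with `X`, so `(X - c)q = QP(X - c)p`. The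
  -- right-hand side has norm at most `‖QP‖ R ‖x‖`, while `X - c ≥ R'` on the range of `Q`. Hence
  -- `‖QP‖ ≤ (R / R') ‖QP‖`, which forces `QP = 0`.
  have key : ∀ x, ‖(Q * P) x‖ ≤ R / R' * ‖Q * P‖ * ‖x‖ := by
    intro x
    set p : X.domain := ⟨P x, hE.apply_mem_domain_of_subset_Icc hS subset_rfl x⟩ with hp
    set q : X.domain := ⟨Q p, hF.apply_mem_domain hT p.2⟩ with hq
    have h1 := hF.le_re_inner_map hT subset_rfl q (F.apply_self hT _)
    have h2 : X q = Q (X p) := hF.map_apply hT p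
    have h3 : X p = hE.truncLin hS subset_rfl x := rfl
    have h4 : X p - (c : ℂ) • (p : 𝓗) = P (X p - (c : ℂ) • (p : 𝓗)) := by
      rw [map_sub, map_smul, h3, hP, ← hE.truncLin_apply_apply hS subset_rfl hS,
        hE.truncLin_apply_self hS subset_rfl]
      congr 2
      exact (E.apply_self hS x).symm
    have h5 : ‖X p - (c : ℂ) • (p : 𝓗)‖ ≤ R * ‖x‖ := hE.norm_truncLin_sub_le hS hR subset_rfl x
    have h6 : X q - (c : ℂ) • (q : 𝓗) = (Q * P) (X p - (c : ℂ) • (p : 𝓗)) := by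
      rw [mul_apply_eq_comp, ← h4, map_sub, map_smul, h2]
    have h7 : ‖X q - (c : ℂ) • (q : 𝓗)‖ ≤ ‖Q * P‖ * (R * ‖x‖) := by
      rw [h6]
      exact (ContinuousLinearMap.le_opNorm _ _).trans (by gcongr)
    have h8 : R' * ‖(q : 𝓗)‖ ^ 2 ≤ (⟪(q : 𝓗), X q - (c : ℂ) • (q : 𝓗)⟫_ℂ).re := by
      rw [inner_sub_right, inner_smul_right, inner_self_eq_norm_sq_to_K, Complex.sub_re]
      have : ((c : ℂ) * (‖(q : 𝓗)‖ : ℂ) ^ 2).re = c * ‖(q : 𝓗)‖ ^ 2 := by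
        rw [← Complex.ofReal_pow, ← Complex.ofReal_mul, Complex.ofReal_re]
      erw [this]
      linarith
    have h9 : R' * ‖(q : 𝓗)‖ ^ 2 ≤ ‖(q : 𝓗)‖ * (‖Q * P‖ * (R * ‖x‖)) :=
      h8.trans ((Complex.re_le_norm _).trans ((norm_inner_le_norm _ _).trans (by gcongr)))
    change ‖(q : 𝓗)‖ ≤ _
    rcases (norm_nonneg (q : 𝓗)).eq_or_lt with h0 | h0
    · rw [← h0]
      positivity
    · rw [div_mul_eq_mul_div, div_mul_eq_mul_div, le_div_iff₀ hR']
      have : ‖(q : 𝓗)‖ * (‖(q : 𝓗)‖ * R') ≤ ‖(q : 𝓗)‖ * (R * ‖Q * P‖ * ‖x‖) := by linarith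
      exact le_of_mul_le_mul_left this h0
  have h1 := ContinuousLinearMap.opNorm_le_bound (Q * P) (by positivity) key
  rw [← norm_eq_zero]
  by_contra h0
  have h2 : 0 < ‖Q * P‖ := lt_of_le_of_ne (norm_nonneg _) (Ne.symm h0)
  have h3 : R / R' < 1 := (div_lt_one hR').2 hRR'
  nlinarith

theorem Ioi_mul_Icc_eq_zero (hF : F.IsSpectralMeasureOf X) (r : ℝ) (n : ℕ) (ψ : 𝓗) :
    F (Set.Ioi r) (E (Set.Icc (-(n : ℝ)) r) ψ) = 0 := by
  by_cases hn : -(n : ℝ) ≤ r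
  · have h1 : ∀ k : ℕ, F (Set.Ici (r + 1 / ((k : ℝ) + 1))) (E (Set.Icc (-(n : ℝ)) r) ψ) = 0 := by
      intro k
      -- Here `c` and `R` are the midpoint and half-length of `[-n, r]`; the gap `1 / (k + 1)`
      -- shrinks with `k`, and the half-lines exhaust `(r, ∞)`.
      have h2 := hE.mul_eq_zero_of_lt hF (c := (r - n) / 2) (R := (r + n) / 2)
        (R' := (r + n) / 2 + 1 / ((k : ℝ) + 1)) (by linarith)
        (by linarith [Nat.one_div_pos_of_nat (α := ℝ) (n := k)])
      rw [show (r - n) / 2 + ((r + n) / 2 + 1 / ((k : ℝ) + 1)) = r + 1 / ((k : ℝ) + 1) by ring,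
        show (r - n) / 2 - (r + n) / 2 = -(n : ℝ) by ring,
        show (r - n) / 2 + (r + n) / 2 = r by ring] at h2
      rw [← mul_apply_eq_comp, h2]
      rfl
    have h2 := F.tendsto_apply_iUnion (s := fun k : ℕ => Set.Ici (r + 1 / ((k : ℝ) + 1)))
      (fun k => measurableSet_Ici)
      (fun k l hkl => Set.Ici_subset_Ici.2 (by gcongr)) (E (Set.Icc (-(n : ℝ)) r) ψ)
    simp only [h1] at h2
    have h3 : (⋃ k : ℕ, Set.Ici (r + 1 / ((k : ℝ) + 1))) = Set.Ioi r := by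
      ext x
      simp only [Set.mem_iUnion, Set.mem_Ici, Set.mem_Ioi]
      constructor
      · rintro ⟨k, hk⟩
        linarith [Nat.one_div_pos_of_nat (α := ℝ) (n := k)]
      · intro hx
        obtain ⟨k, hk⟩ := exists_nat_one_div_lt (sub_pos.2 hx)
        exact ⟨k, by linarith⟩
    rw [h3] at h2
    exact tendsto_nhds_unique h2 tendsto_const_nhds
  · rw [Set.Icc_eq_empty hn, E.apply_empty, map_zero]

theorem Ioi_mul_Iic_eq_zero (hF : F.IsSpectralMeasureOf X) (r : ℝ) (ψ : 𝓗) :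
    F (Set.Ioi r) (E (Set.Iic r) ψ) = 0 := by
  have h1 := E.tendsto_apply_iUnion (s := fun n : ℕ => Set.Icc (-(n : ℝ)) r)
    (fun k => measurableSet_Icc)
    (fun k l hkl => Set.Icc_subset_Icc (neg_le_neg (Nat.cast_le.2 hkl)) le_rfl) ψ
  have h2 : (⋃ n : ℕ, Set.Icc (-(n : ℝ)) r) = Set.Iic r := by
    ext x
    simp only [Set.mem_iUnion, Set.mem_Icc, Set.mem_Iic]
    refine ⟨fun ⟨_, h⟩ => h.2, fun h => ?_⟩
    obtain ⟨n, hn⟩ := exists_nat_ge (-x)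
    exact ⟨n, by linarith, h⟩
  rw [h2] at h1
  have h3 := ((F (Set.Ioi r)).continuous.tendsto _).comp h1
  refine tendsto_nhds_unique h3 (tendsto_const_nhds.congr fun n => ?_)
  exact (hE.Ioi_mul_Icc_eq_zero hF r n ψ).symm

/-- The spectral measure of an operator is unique. -/
theorem apply_Iic_eq (hF : F.IsSpectralMeasureOf X) (r : ℝ) : E (Set.Iic r) = F (Set.Iic r) := by
  -- This is inclusion of ranges; the opposite inclusion and adjoints then give equality.
  have key : ∀ {E F : SpectralMeasure 𝓗}, E.IsSpectralMeasureOf X → F.IsSpectralMeasureOf X →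
      F (Set.Iic r) * E (Set.Iic r) = E (Set.Iic r) := by
    intro E F hE hF
    ext ψ
    have h := hE.Ioi_mul_Iic_eq_zero hF r ψ
    rw [← Set.compl_Iic, F.compl_eq measurableSet_Iic, sub_apply, one_apply_eq_self,
      sub_eq_zero] at h
    exact h.symm
  have h1 := congrArg star (key hE hF)
  rw [star_mul, (E.isProj _ measurableSet_Iic).isSelfAdjoint.star_eq,
    (F.isProj _ measurableSet_Iic).isSelfAdjoint.star_eq, key hF hE] at h1
  exact h1.symm

end IsSpectralMeasureOf

end SpectralMeasure

end QMeas

/-! ### Truth values of equality between Dedekind cuts. -/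

namespace QSet

universe u w

/-- The rank is invariant under extensional equality of sets, so it separates the numerals. -/
theorem rank_ofNat (n : ℕ) : (PSet.ofNat n).rank = n := by
  induction n with
  | zero => exact PSet.rank_empty.trans Nat.cast_zero.symm
  | succ n ih =>
    change (insert (PSet.ofNat n) (PSet.ofNat n)).rank = _
    rw [PSet.rank_insert, ih, max_eq_left (Order.le_succ _)]
    simp

theorem ratSet_equiv_iff {r s : ℚ} : (ratSet r).Equiv (ratSet s) ↔ r = s := by
  refine ⟨fun h => ?_, fun h => h ▸ PSet.Equiv.refl _⟩
  have h1 := PSet.rank_congr h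
  rw [ratSet, ratSet, rank_ofNat, rank_ofNat, Nat.cast_inj] at h1
  exact Encodable.encode_injective h1

variable {Q : Type u} [CompleteLattice Q] [Compl Q]

theorem sasaki_top_left (h : (⊤ : Q)ᶜ = ⊥) (q : Q) : sasaki ⊤ q = q := by
  simp [sasaki, h]

/-- Check names take only the value `⊤`, and a Sasaki implication from `⊤` returns its conclusion,
so equality of check names is two-valued and follows equality of the sets. -/
theorem eqVal_check (h : (⊤ : Q)ᶜ = ⊥) (x y : PSet.{w}) :
    (x.Equiv y → QName.eqVal (QName.check x : QName.{u, w} Q) (QName.check y) = ⊤) ∧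
      (¬ x.Equiv y → QName.eqVal (QName.check x : QName.{u, w} Q) (QName.check y) = ⊥) := by
  induction x generalizing y with
  | mk ι A ih =>
    cases y with
    | mk κ B =>
      simp only [QName.check, QName.eqVal, sasaki_top_left h, top_inf_eq, PSet.Equiv]
      refine ⟨fun ⟨h1, h2⟩ => ?_, fun hne => ?_⟩
      · refine top_unique (le_inf (le_iInf fun i => ?_) (le_iInf fun j => ?_))
        · obtain ⟨j, hj⟩ := h1 i
          exact le_iSup_of_le j (((ih i (B j)).1 hj).ge)
        · obtain ⟨i, hi⟩ := h2 j
          exact le_iSup_of_le i (((ih i (B j)).1 hi).ge)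
      · rw [not_and_or] at hne
        push Not at hne
        refine bot_unique ?_
        rcases hne with ⟨i, hi⟩ | ⟨j, hj⟩
        · refine (inf_le_left.trans (iInf_le _ i)).trans (iSup_le fun j => ?_)
          exact ((ih i (B j)).2 (hi j)).le
        · refine (inf_le_right.trans (iInf_le _ j)).trans (iSup_le fun i => ?_)
          exact ((ih i (B j)).2 (hj i)).le

/-- Only the term of index `r` survives in the supremum. -/
theorem memVal_cut (h : (⊤ : Q)ᶜ = ⊥) (f : ℚ → Q) (r : ℚ) :
    QName.memVal (QName.check (ratSet r)) (cut f) = f r := by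
  refine le_antisymm (iSup_le fun s => ?_) (le_iSup_of_le r ?_)
  · by_cases hrs : r = s
    · subst hrs
      exact inf_le_left
    · rw [(eqVal_check h _ _).2 (mt ratSet_equiv_iff.1 hrs)]
      simp
  · rw [(eqVal_check h _ _).1 (PSet.Equiv.refl _), inf_top_eq]

/-- The truth value of the equality of two cuts. -/
theorem eqVal_cut (h : (⊤ : Q)ᶜ = ⊥) (e f : ℚ → Q) :
    QName.eqVal (cut e) (cut f) = (⨅ r, sasaki (e r) (f r)) ⊓ ⨅ r, sasaki (f r) (e r) := by
  have h1 := QName.eqVal_eq ℚ ℚ (fun r => QName.check (ratSet r)) e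
    (fun r => QName.check (ratSet r)) f
  change _ = (⨅ r, sasaki (e r) (QName.memVal (QName.check (ratSet r)) (cut f))) ⊓
    (⨅ r, sasaki (f r) (QName.memVal (QName.check (ratSet r)) (cut e))) at h1
  rw [show QName.eqVal (cut e) (cut f) = _ from h1]
  simp only [memVal_cut h]

end QSet

namespace QMeas

universe u v

/-! ### Truth values as closed subspaces. -/

section Logic

variable {𝓗 : Type u} [NormedAddCommGroup 𝓗] [InnerProductSpace ℂ 𝓗] [CompleteSpace 𝓗]

theorem mem_range_closure_iff {P : 𝓗 →L[ℂ] 𝓗} (hP : IsStarProjection P) {ψ : 𝓗} :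
    ψ ∈ P.range.closure ↔ P ψ = ψ := by
  constructor
  · intro h
    have hle : P.range.closure ≤ ⟨(P - 1).ker, (P - 1).isClosed_ker⟩ := by
      rw [Submodule.closure_le]
      rintro _ ⟨φ, rfl⟩
      change (P - 1) (P φ) = 0
      rw [sub_apply, ← mul_apply_eq_comp, hP.isIdempotentElem.eq]
      simp
    have h1 : (P - 1) ψ = 0 := hle h
    rwa [sub_apply, one_apply_eq_self, sub_eq_zero] at h1
  · intro h
    exact subset_closure ⟨ψ, h⟩

/-- The `ψ` with `QPψ = Pψ` form a closed subspace containing both `Pᗮ` and `P ∧ Q`; conversely `ψ =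
(ψ - Pψ) + Pψ` exhibits such a `ψ` in their sum. -/
theorem mem_sasaki_iff {P Q : 𝓗 →L[ℂ] 𝓗} (hP : IsStarProjection P) (hQ : IsStarProjection Q)
    {ψ : 𝓗} : ψ ∈ QSet.sasaki P.range.closure Q.range.closure ↔ Q (P ψ) = P ψ := by
  have hPP : ∀ φ, P (P φ) = P φ := fun φ => by
    rw [← mul_apply_eq_comp, hP.isIdempotentElem.eq]
  have hPs : ∀ φ χ, ⟪P φ, χ⟫_ℂ = ⟪φ, P χ⟫_ℂ := fun φ χ => by
    conv_lhs => rw [← hP.isSelfAdjoint.star_eq, ContinuousLinearMap.star_eq_adjoint,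
      ContinuousLinearMap.adjoint_inner_left]
  constructor
  · intro h
    have hle : QSet.sasaki P.range.closure Q.range.closure ≤
        ⟨(Q * P - P).ker, (Q * P - P).isClosed_ker⟩ := by
      refine sup_le (fun φ hφ => ?_) (fun φ hφ => ?_)
      · have h1 : P φ = 0 := by
          have h2 := hφ (P φ) (subset_closure ⟨φ, rfl⟩)
          rw [← hPP φ, hPs] at h2
          exact inner_self_eq_zero.1 h2
        change (Q * P - P) φ = 0
        rw [sub_apply, mul_apply_eq_comp, h1, map_zero, sub_zero]
      · have h1 := (mem_range_closure_iff hP).1 hφ.1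
        have h2 := (mem_range_closure_iff hQ).1 hφ.2
        change (Q * P - P) φ = 0
        rw [sub_apply, mul_apply_eq_comp, h1, h2, sub_self]
    have h1 : (Q * P - P) ψ = 0 := hle h
    rwa [sub_apply, mul_apply_eq_comp, sub_eq_zero] at h1
  · intro h
    refine subset_closure (Submodule.mem_sup.2 ⟨ψ - P ψ, ?_, P ψ, ?_, sub_add_cancel _ _⟩)
    · intro φ hφ
      rw [inner_sub_right, ← hPs, (mem_range_closure_iff hP).1 hφ, sub_self]
    · exact ⟨(mem_range_closure_iff hP).2 (hPP ψ), (mem_range_closure_iff hQ).2 h⟩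

/-- Under the two conditions all terms in the expansion of `‖Pψ - Qψ‖²` cancel. They are what the
two opposite Sasaki implications provide. -/
theorem apply_eq_apply_iff {P Q : 𝓗 →L[ℂ] 𝓗} (hP : IsStarProjection P) (hQ : IsStarProjection Q)
    {ψ : 𝓗} : P ψ = Q ψ ↔ Q (P ψ) = P ψ ∧ P (Q ψ) = Q ψ := by
  have hs : ∀ {R : 𝓗 →L[ℂ] 𝓗}, IsStarProjection R → ∀ φ χ, ⟪R φ, χ⟫_ℂ = ⟪φ, R χ⟫_ℂ :=
    fun {R} hR φ χ => by
      conv_lhs => rw [← hR.isSelfAdjoint.star_eq, ContinuousLinearMap.star_eq_adjoint,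
        ContinuousLinearMap.adjoint_inner_left]
  have hi : ∀ {R : 𝓗 →L[ℂ] 𝓗}, IsStarProjection R → ∀ φ, R (R φ) = R φ := fun {R} hR φ => by
    rw [← mul_apply_eq_comp, hR.isIdempotentElem.eq]
  constructor
  · intro h
    exact ⟨by rw [h, hi hQ], by rw [← h, hi hP]⟩
  · rintro ⟨h1, h2⟩
    have h3 : ⟪P ψ - Q ψ, P ψ - Q ψ⟫_ℂ = 0 := by
      have e1 : ⟪P ψ, P ψ⟫_ℂ = ⟪ψ, P ψ⟫_ℂ := by rw [hs hP, hi hP]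
      have e2 : ⟪Q ψ, Q ψ⟫_ℂ = ⟪ψ, Q ψ⟫_ℂ := by rw [hs hQ, hi hQ]
      have e3 : ⟪P ψ, Q ψ⟫_ℂ = ⟪ψ, Q ψ⟫_ℂ := by rw [hs hP, h2]
      have e4 : ⟪Q ψ, P ψ⟫_ℂ = ⟪ψ, P ψ⟫_ℂ := by rw [hs hQ, h1]
      rw [inner_sub_left, inner_sub_right, inner_sub_right, e1, e2, e3, e4]
      ring
    exact sub_eq_zero.1 (inner_self_eq_zero.1 h3)

/-- The truth value `⟦X̃ = Ỹ⟧` consists of the vectors on which the spectral families of `X` and `Y`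
agree. -/
theorem SpectralMeasure.mem_eqVal_iff (E F : SpectralMeasure 𝓗) {ψ : 𝓗} :
    ψ ∈ QSet.QName.eqVal E.real F.real ↔
      ∀ r : ℚ, E (Set.Iic (r : ℝ)) ψ = F (Set.Iic (r : ℝ)) ψ := by
  rw [SpectralMeasure.real, SpectralMeasure.real,
    QSet.eqVal_cut ClosedSubmodule.top_orthogonal_eq_bot, ClosedSubmodule.mem_inf,
    ClosedSubmodule.mem_iInf, ClosedSubmodule.mem_iInf, ← forall_and]
  refine forall_congr' fun r => ?_
  have hP := E.isProj (Set.Iic (r : ℝ)) measurableSet_Iic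
  have hQ := F.isProj (Set.Iic (r : ℝ)) measurableSet_Iic
  rw [SpectralMeasure.family, SpectralMeasure.family, mem_sasaki_iff hP hQ, mem_sasaki_iff hQ hP,
    apply_eq_apply_iff hP hQ]

end Logic

/-! ### Hilbert–Schmidt sums, traces and certainty in a state. -/

section Trace

variable {𝓗 : Type u} [NormedAddCommGroup 𝓗] [InnerProductSpace ℂ 𝓗] [CompleteSpace 𝓗]
variable {𝓖 : Type v} [NormedAddCommGroup 𝓖] [InnerProductSpace ℂ 𝓖] [CompleteSpace 𝓖]
variable {ι κ : Type*}

/-- Moves nonnegative sums to `[0, ∞]`, where summations may be interchanged freely. -/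
theorem hasSum_iff_tsum_ofReal {f : ι → ℝ} (hf : ∀ i, 0 ≤ f i) {t : ℝ} (ht : 0 ≤ t) :
    HasSum f t ↔ ∑' i, ENNReal.ofReal (f i) = ENNReal.ofReal t := by
  constructor
  · intro h
    rw [← ENNReal.ofReal_tsum_of_nonneg hf h.summable, h.tsum_eq]
  · intro h
    have h1 : ∑' i, ENNReal.ofReal (f i) ≠ ⊤ := h ▸ ENNReal.ofReal_ne_top
    have h2 := ENNReal.hasSum_toReal h1
    simp only [ENNReal.toReal_ofReal (hf _)] at h2
    have h3 := congrArg ENNReal.toReal h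
    rw [ENNReal.tsum_toReal_eq (fun i => ENNReal.ofReal_ne_top), ENNReal.toReal_ofReal ht] at h3
    simp only [ENNReal.toReal_ofReal (hf _)] at h3
    rwa [h3] at h2

omit [CompleteSpace 𝓗] in
theorem hasSum_norm_inner_sq (b : HilbertBasis ι ℂ 𝓗) (x : 𝓗) :
    HasSum (fun i => ‖⟪b i, x⟫_ℂ‖ ^ 2) (‖x‖ ^ 2) := by
  have h := Complex.hasSum_re (b.hasSum_inner_mul_inner x x)
  rw [inner_self_eq_norm_sq_to_K] at h
  convert h using 1
  · ext i
    rw [← inner_conj_symm x, ← Complex.normSq_eq_conj_mul_self, Complex.ofReal_re,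
      Complex.normSq_eq_norm_sq]
  · simp [← Complex.ofReal_pow]

/-- Parseval in each space turns both sides into the same double sum of squared matrix entries, up
to the order of summation. -/
theorem tsum_ofReal_norm_sq_adjoint (T : 𝓗 →L[ℂ] 𝓖) (b : HilbertBasis ι ℂ 𝓗)
    (c : HilbertBasis κ ℂ 𝓖) :
    ∑' i, ENNReal.ofReal (‖T (b i)‖ ^ 2) =
      ∑' j, ENNReal.ofReal (‖ContinuousLinearMap.adjoint T (c j)‖ ^ 2) := by
  have h1 : ∀ i, ENNReal.ofReal (‖T (b i)‖ ^ 2) =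
      ∑' j, ENNReal.ofReal (‖⟪c j, T (b i)⟫_ℂ‖ ^ 2) := fun i =>
    ((hasSum_iff_tsum_ofReal (fun _ => by positivity) (by positivity)).1
      (hasSum_norm_inner_sq c _)).symm
  have h2 : ∀ j, ENNReal.ofReal (‖ContinuousLinearMap.adjoint T (c j)‖ ^ 2) =
      ∑' i, ENNReal.ofReal (‖⟪c j, T (b i)⟫_ℂ‖ ^ 2) := fun j => by
    rw [← (hasSum_iff_tsum_ofReal (fun _ => by positivity) (by positivity)).1
      (hasSum_norm_inner_sq b (ContinuousLinearMap.adjoint T (c j)))]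
    refine tsum_congr fun i => ?_
    rw [ContinuousLinearMap.adjoint_inner_right, ← inner_conj_symm, RCLike.norm_conj]
  simp only [h1, h2]
  exact ENNReal.tsum_comm

/-- The Hilbert-Schmidt norm does not depend on the basis. -/
theorem hasSum_norm_sq_of_basis (T : 𝓗 →L[ℂ] 𝓖) (b : HilbertBasis ι ℂ 𝓗) (b' : HilbertBasis κ ℂ 𝓗)
    {t : ℝ} (h : HasSum (fun i => ‖T (b i)‖ ^ 2) t) : HasSum (fun j => ‖T (b' j)‖ ^ 2) t := by
  obtain ⟨w, c, -⟩ := exists_hilbertBasis ℂ 𝓖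
  have ht : 0 ≤ t := h.nonneg fun _ => by positivity
  rw [hasSum_iff_tsum_ofReal (fun _ => by positivity) ht] at h ⊢
  rw [tsum_ofReal_norm_sq_adjoint T b' c, ← tsum_ofReal_norm_sq_adjoint T b c, h]

theorem summable_norm_sq_adjoint (T : 𝓗 →L[ℂ] 𝓖) (b : HilbertBasis ι ℂ 𝓗) (c : HilbertBasis κ ℂ 𝓖)
    (h : Summable fun i => ‖T (b i)‖ ^ 2) :
    Summable fun j => ‖ContinuousLinearMap.adjoint T (c j)‖ ^ 2 := by
  have ht : 0 ≤ ∑' i, ‖T (b i)‖ ^ 2 := tsum_nonneg fun _ => by positivity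
  have h1 := (hasSum_iff_tsum_ofReal (fun _ => by positivity) ht).1 h.hasSum
  rw [tsum_ofReal_norm_sq_adjoint T b c] at h1
  exact ((hasSum_iff_tsum_ofReal (fun _ => by positivity) ht).2 h1).summable

/-- This is cyclicity of the trace for Hilbert–Schmidt operators: both sums are iterated sums of `⟪A
bᵢ, bₖ⟫ ⟪bₖ, B bᵢ⟫`, a family dominated by the squared matrix entries of `A` and `B`. -/
theorem hasSum_inner_adjoint (b : HilbertBasis ι ℂ 𝓗) {A B : 𝓗 →L[ℂ] 𝓗}
    (hA : Summable fun i => ‖A (b i)‖ ^ 2) (hB : Summable fun i => ‖B (b i)‖ ^ 2) {t : ℂ}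
    (h : HasSum (fun i => ⟪A (b i), B (b i)⟫_ℂ) t) :
    HasSum (fun k => ⟪ContinuousLinearMap.adjoint B (b k), ContinuousLinearMap.adjoint A (b k)⟫_ℂ)
      t := by
  have hsq : ∀ {T : 𝓗 →L[ℂ] 𝓗}, (Summable fun i => ‖T (b i)‖ ^ 2) →
      Summable fun p : ι × ι => ‖⟪b p.2, T (b p.1)⟫_ℂ‖ ^ 2 := by
    intro T hT
    refine (summable_prod_of_nonneg (f := fun p : ι × ι => ‖⟪b p.2, T (b p.1)⟫_ℂ‖ ^ 2)
      (fun _ => sq_nonneg _)).2 ⟨fun i => (hasSum_norm_inner_sq b (T (b i))).summable, ?_⟩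
    exact hT.congr fun i => (hasSum_norm_inner_sq b (T (b i))).tsum_eq.symm
  have hs : Summable fun p : ι × ι => ⟪A (b p.1), b p.2⟫_ℂ * ⟪b p.2, B (b p.1)⟫_ℂ := by
    refine Summable.of_norm_bounded ((hsq hA).add (hsq hB)) fun p => ?_
    rw [norm_mul, ← inner_conj_symm, RCLike.norm_conj]
    nlinarith [sq_nonneg (‖⟪b p.2, A (b p.1)⟫_ℂ‖ - ‖⟪b p.2, B (b p.1)⟫_ℂ‖),
      sq_nonneg (‖⟪b p.2, A (b p.1)⟫_ℂ‖ + ‖⟪b p.2, B (b p.1)⟫_ℂ‖)]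
  have h1 := hs.hasSum.prod_fiberwise fun i => b.hasSum_inner_mul_inner (A (b i)) (B (b i))
  have h2 := ((Equiv.prodComm ι ι).hasSum_iff.2 hs.hasSum).prod_fiberwise
    (g := fun k => ⟪ContinuousLinearMap.adjoint B (b k), ContinuousLinearMap.adjoint A (b k)⟫_ℂ)
    fun k => by
      refine (b.hasSum_inner_mul_inner (ContinuousLinearMap.adjoint B (b k))
        (ContinuousLinearMap.adjoint A (b k))).congr_fun fun i => ?_
      simp only [Function.comp_apply, Equiv.prodComm_apply, Prod.fst_swap, Prod.snd_swap]
      rw [ContinuousLinearMap.adjoint_inner_left, ContinuousLinearMap.adjoint_inner_right]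
      exact mul_comm _ _
  rw [h.unique h1]
  exact h2

theorem IsPositive.exists_sqrt {τ : 𝓗 →L[ℂ] 𝓗} (hτ : τ.IsPositive) :
    ∃ s : 𝓗 →L[ℂ] 𝓗, IsSelfAdjoint s ∧ s * s = τ := by
  have h : 0 ≤ τ := (ContinuousLinearMap.nonneg_iff_isPositive τ).2 hτ
  exact ⟨CFC.sqrt τ, (CFC.sqrt_nonneg τ).isSelfAdjoint, CFC.sqrt_mul_sqrt_self τ⟩

theorem inner_apply_of_isSelfAdjoint {s : 𝓗 →L[ℂ] 𝓗} (hs : IsSelfAdjoint s) (φ ψ : 𝓗) :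
    ⟪s φ, ψ⟫_ℂ = ⟪φ, s ψ⟫_ℂ := by
  conv_lhs => rw [← hs.star_eq, ContinuousLinearMap.star_eq_adjoint,
    ContinuousLinearMap.adjoint_inner_left]

theorem inner_mul_self_apply {s : 𝓗 →L[ℂ] 𝓗} (hs : IsSelfAdjoint s) (ψ : 𝓗) :
    ⟪ψ, (s * s) ψ⟫_ℂ = ((‖s ψ‖ ^ 2 : ℝ) : ℂ) := by
  rw [mul_apply_eq_comp, ← inner_apply_of_isSelfAdjoint hs, inner_self_eq_norm_sq_to_K]
  simp

theorem hasSum_norm_sq_of_hasTrace {s : 𝓗 →L[ℂ] 𝓗} (hs : IsSelfAdjoint s) {t : ℝ}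
    (h : HasTrace (s * s) t) (b : HilbertBasis ι ℂ 𝓗) : HasSum (fun i => ‖s (b i)‖ ^ 2) t := by
  obtain ⟨w, c, -⟩ := exists_hilbertBasis ℂ 𝓗
  have h1 := Complex.hasSum_re (h w c)
  simp only [inner_mul_self_apply hs, Complex.ofReal_re] at h1
  exact hasSum_norm_sq_of_basis s c b h1

theorem hasTrace_of_hasSum_norm_sq {s : 𝓗 →L[ℂ] 𝓗} (hs : IsSelfAdjoint s) {t : ℝ}
    (b : HilbertBasis ι ℂ 𝓗) (h : HasSum (fun i => ‖s (b i)‖ ^ 2) t) : HasTrace (s * s) t := by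
  intro κ c
  simp only [inner_mul_self_apply hs]
  exact Complex.hasSum_ofReal.2 (hasSum_norm_sq_of_basis s b c h)

/-- If `Tr[R† R s²] = 0` then `R s = 0`. -/
theorem comp_eq_zero_of_hasSum_zero {s : 𝓗 →L[ℂ] 𝓗} (hs : IsSelfAdjoint s) (b : HilbertBasis ι ℂ 𝓗)
    (hsum : Summable fun i => ‖s (b i)‖ ^ 2) (R : 𝓗 →L[ℂ] 𝓖)
    (h : HasSum (fun i => ⟪R (b i), R (s (s (b i)))⟫_ℂ) 0) : R ∘L s = 0 := by
  set G : 𝓗 →L[ℂ] 𝓗 := ContinuousLinearMap.adjoint R ∘L R with hG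
  -- The trace is written as `∑ ⟪(G s)† bᵢ, s bᵢ⟫`; cyclicity then moves one factor `s` to the left
  -- and leaves `∑ ‖R s bₖ‖²`.
  set A : 𝓗 →L[ℂ] 𝓗 := ContinuousLinearMap.adjoint (G ∘L s) with hA
  have h1 : Summable fun i => ‖(G ∘L s) (b i)‖ ^ 2 := by
    refine Summable.of_nonneg_of_le (fun _ => by positivity) (fun i => ?_)
      (hsum.mul_left (‖G‖ ^ 2))
    rw [← mul_pow]
    gcongr
    exact G.le_opNorm _
  have h2 : HasSum (fun i => ⟪A (b i), s (b i)⟫_ℂ) 0 := by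
    convert h using 2 with i
    rw [hA, ContinuousLinearMap.adjoint_inner_left, hG]
    simp only [ContinuousLinearMap.comp_apply]
    rw [ContinuousLinearMap.adjoint_inner_right]
  have h3 : HasSum (fun k => ⟪ContinuousLinearMap.adjoint s (b k),
      ContinuousLinearMap.adjoint A (b k)⟫_ℂ) 0 :=
    hasSum_inner_adjoint b (summable_norm_sq_adjoint _ b b h1) hsum h2
  have h4 : ∀ k, ⟪ContinuousLinearMap.adjoint s (b k), ContinuousLinearMap.adjoint A (b k)⟫_ℂ =
      ((‖R (s (b k))‖ ^ 2 : ℝ) : ℂ) := by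
    intro k
    rw [hA, ContinuousLinearMap.adjoint_adjoint, ← ContinuousLinearMap.star_eq_adjoint, hs.star_eq,
      hG]
    simp only [ContinuousLinearMap.comp_apply]
    rw [ContinuousLinearMap.adjoint_inner_right, inner_self_eq_norm_sq_to_K]
    simp
  simp only [h4] at h3
  have h5 := (hasSum_zero_iff_of_nonneg (f := fun k => ‖R (s (b k))‖ ^ 2) fun k => sq_nonneg _).1
    (Complex.hasSum_ofReal.1 (by simpa only [Complex.ofReal_zero] using h3))
  have h6 : ∀ k, (R ∘L s) (b k) = (0 : 𝓗 →L[ℂ] 𝓖) (b k) := fun k => by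
    have := congrFun h5 k
    simpa using this
  refine ContinuousLinearMap.ext_on (s := Set.range b) ?_ ?_
  · rw [Submodule.dense_iff_topologicalClosure_eq_top]
    exact b.dense_span
  · rintro _ ⟨k, rfl⟩
    exact h6 k

/-- The projection on `S` has probability one in the state `τ` if and only if the range of `τ` is
contained in `S`. -/
theorem hasTrace_starProjection_comp_iff {τ : 𝓗 →L[ℂ] 𝓗} (hτ : IsDensityOperator τ)
    (S : ClosedSubmodule ℂ 𝓗) :
    HasTrace (S.toSubmodule.starProjection ∘L τ) 1 ↔ ∀ ψ, τ ψ ∈ S := by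
  set P := S.toSubmodule.starProjection with hP
  have hmem : ∀ x, P x = x ↔ x ∈ S := fun x => Submodule.starProjection_eq_self_iff
  constructor
  · intro h
    obtain ⟨s, hs, rfl⟩ := IsPositive.exists_sqrt hτ.1
    obtain ⟨w, b, -⟩ := exists_hilbertBasis ℂ 𝓗
    have hsum := (hasSum_norm_sq_of_hasTrace hs (t := 1) (by simpa using hτ.2) b).summable
    -- This is `Tr[τ] - Tr[Pτ] = 0`, with `1 - P` written as `(1 - P)†(1 - P)`.
    have h1 : HasSum (fun i => ⟪(1 - P) (b i), (1 - P) (s (s (b i)))⟫_ℂ) 0 := by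
      have h2 := (hτ.2 w b).sub (h w b)
      rw [sub_self] at h2
      refine h2.congr_fun fun i => ?_
      have hPs : IsSelfAdjoint (1 - P) :=
        (isStarProjection_starProjection (U := S.toSubmodule)).one_sub.isSelfAdjoint
      have hPi : ∀ x, (1 - P) ((1 - P) x) = (1 - P) x := fun x => by
        rw [← mul_apply_eq_comp,
          (isStarProjection_starProjection (U := S.toSubmodule)).one_sub.isIdempotentElem.eq]
      rw [inner_apply_of_isSelfAdjoint hPs, hPi, sub_apply, one_apply_eq_self, inner_sub_right]
      rfl
    have h2 := comp_eq_zero_of_hasSum_zero hs b hsum (1 - P) h1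
    intro ψ
    have h3 := congrArg (fun T : 𝓗 →L[ℂ] 𝓗 => T (s ψ)) h2
    simp only [ContinuousLinearMap.comp_apply, sub_apply, one_apply_eq_self] at h3
    exact (hmem _).1 (sub_eq_zero.1 h3).symm
  · intro h
    have : P ∘L τ = τ := by
      ext ψ
      exact (hmem _).2 (h ψ)
    rw [this]
    exact hτ.2

end Trace

/-! ### Tensor products of operators, bases and states. -/

section Tensor

variable {H : Type u} [NormedAddCommGroup H] [InnerProductSpace ℂ H]
variable {K : Type v} [NormedAddCommGroup K] [InnerProductSpace ℂ K]

theorem inner_tmul (x x' : H) (y y' : K) :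
    ⟪tmul x y, tmul x' y'⟫_ℂ = ⟪x, x'⟫_ℂ * ⟪y, y'⟫_ℂ := by
  rw [tmul, tmul, UniformSpace.Completion.inner_coe, TensorProduct.inner_tmul]

variable (K) in
/-- The bounded operator `y ↦ x ⊗ y`. -/
noncomputable def tmulL (x : H) : K →L[ℂ] HTensor H K :=
  UniformSpace.Completion.toComplL ∘L TensorProduct.mkL ℂ H K x

@[simp]
theorem tmulL_apply (x : H) (y : K) : tmulL K x y = tmul x y := rfl

variable (H) in
/-- The bounded operator `x ↦ x ⊗ y`. -/
noncomputable def tmulR (y : K) : H →L[ℂ] HTensor H K :=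
  UniformSpace.Completion.toComplL ∘L (TensorProduct.mkL ℂ H K).flip y

@[simp]
theorem tmulR_apply (x : H) (y : K) : tmulR H y x = tmul x y := rfl

@[simp]
theorem tensorOp_tmul (S : H →L[ℂ] H) (T : K →L[ℂ] K) (x : H) (y : K) :
    tensorOp S T (tmul x y) = tmul (S x) (T y) := by
  rw [tensorOp, tmul, ContinuousLinearMap.completion_apply_coe, TensorProduct.mapL_tmul, tmul]

theorem dense_span_tmul :
    Dense (Submodule.span ℂ (Set.range fun p : H × K => tmul p.1 p.2) : Set (HTensor H K)) := by
  have h := UniformSpace.Completion.denseRange_coe (α := H ⊗[ℂ] K)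
  refine Dense.mono ?_ h
  rintro _ ⟨t, rfl⟩
  induction t with
  | zero => exact (UniformSpace.Completion.coe_zero (α := H ⊗[ℂ] K)) ▸ Submodule.zero_mem _
  | tmul x y => exact Submodule.subset_span ⟨(x, y), rfl⟩
  | add a b ha hb =>
    rw [UniformSpace.Completion.coe_add]
    exact Submodule.add_mem _ ha hb

theorem ext_tmul {W : Type*} [NormedAddCommGroup W] [InnerProductSpace ℂ W]
    {S T : HTensor H K →L[ℂ] W} (h : ∀ x y, S (tmul x y) = T (tmul x y)) : S = T := by
  refine ContinuousLinearMap.ext_on dense_span_tmul ?_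
  rintro _ ⟨p, rfl⟩
  exact h _ _

theorem tensorOp_mul (S S' : H →L[ℂ] H) (T T' : K →L[ℂ] K) :
    tensorOp (S * S') (T * T') = tensorOp S T * tensorOp S' T' :=
  ext_tmul fun x y => by
    rw [mul_apply_eq_comp, tensorOp_tmul, tensorOp_tmul, tensorOp_tmul]
    rfl

theorem tensorOp_add_left (S S' : H →L[ℂ] H) (T : K →L[ℂ] K) :
    tensorOp (S + S') T = tensorOp S T + tensorOp S' T :=
  ext_tmul fun x y => by
    rw [add_apply, tensorOp_tmul, tensorOp_tmul, tensorOp_tmul, ← tmulR_apply, add_apply, map_add]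
    rfl

theorem tensorOp_smul_left (c : ℂ) (S : H →L[ℂ] H) (T : K →L[ℂ] K) :
    tensorOp (c • S) T = c • tensorOp S T :=
  ext_tmul fun x y => by
    change _ = c • tensorOp S T (tmul x y)
    rw [tensorOp_tmul, tensorOp_tmul, ← tmulR_apply, ← tmulR_apply, ← map_smul]
    rfl

variable (H) in
/-- The map `S ↦ S ⊗ T`, as a linear map. -/
noncomputable def tensorOpLin (T : K →L[ℂ] K) : (H →L[ℂ] H) →ₗ[ℂ] HTensor H K →L[ℂ] HTensor H K where
  toFun S := tensorOp S T
  map_add' S S' := tensorOp_add_left S S' T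
  map_smul' c S := tensorOp_smul_left c S T

theorem norm_tensorOp_le (S : H →L[ℂ] H) (T : K →L[ℂ] K) : ‖tensorOp S T‖ ≤ ‖S‖ * ‖T‖ := by
  refine ContinuousLinearMap.opNorm_le_bound _ (by positivity) fun p => ?_
  induction p using UniformSpace.Completion.induction_on with
  | hp => exact isClosed_le (by fun_prop) (by fun_prop)
  | ih t =>
    rw [tensorOp, ContinuousLinearMap.completion_apply_coe, UniformSpace.Completion.norm_coe,
      UniformSpace.Completion.norm_coe]
    exact (ContinuousLinearMap.le_opNorm _ _).trans
      (by gcongr; exact TensorProduct.norm_mapL_le _ _)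

variable [CompleteSpace H] [CompleteSpace K]

theorem adjoint_tensorOp (S : H →L[ℂ] H) (T : K →L[ℂ] K) :
    ContinuousLinearMap.adjoint (tensorOp S T) =
      tensorOp (ContinuousLinearMap.adjoint S) (ContinuousLinearMap.adjoint T) := by
  refine ext_tmul fun x y => ?_
  refine ext_inner_right ℂ fun q => ?_
  have h : innerSL ℂ (ContinuousLinearMap.adjoint (tensorOp S T) (tmul x y)) =
      innerSL ℂ (tensorOp (ContinuousLinearMap.adjoint S) (ContinuousLinearMap.adjoint T)
        (tmul x y)) := by
    refine ext_tmul fun x' y' => ?_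
    rw [innerSL_apply_apply, innerSL_apply_apply, ContinuousLinearMap.adjoint_inner_left,
      tensorOp_tmul, tensorOp_tmul, inner_tmul, inner_tmul, ContinuousLinearMap.adjoint_inner_left,
      ContinuousLinearMap.adjoint_inner_left]
  exact congrArg (fun f : HTensor H K →L[ℂ] ℂ => f q) h

theorem isSelfAdjoint_tensorOp {S : H →L[ℂ] H} {T : K →L[ℂ] K} (hS : IsSelfAdjoint S)
    (hT : IsSelfAdjoint T) : IsSelfAdjoint (tensorOp S T) := by
  rw [IsSelfAdjoint, ContinuousLinearMap.star_eq_adjoint, adjoint_tensorOp,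
    ← ContinuousLinearMap.star_eq_adjoint, ← ContinuousLinearMap.star_eq_adjoint, hS.star_eq,
    hT.star_eq]

theorem isStarProjection_tensorOp {S : H →L[ℂ] H} {T : K →L[ℂ] K} (hS : IsStarProjection S)
    (hT : IsStarProjection T) : IsStarProjection (tensorOp S T) where
  isIdempotentElem := by
    rw [IsIdempotentElem, ← tensorOp_mul, hS.isIdempotentElem.eq, hT.isIdempotentElem.eq]
  isSelfAdjoint := isSelfAdjoint_tensorOp hS.isSelfAdjoint hT.isSelfAdjoint

variable {ι κ : Type*}

/-- The products of the vectors of two orthonormal bases form an orthonormal basis. -/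
noncomputable def tensorBasis (b : HilbertBasis ι ℂ H) (c : HilbertBasis κ ℂ K) :
    HilbertBasis (ι × κ) ℂ (HTensor H K) :=
  HilbertBasis.mk (v := fun p : ι × κ => tmul (b p.1) (c p.2))
    (by
      classical
      rw [orthonormal_iff_ite]
      intro p q
      rw [inner_tmul, orthonormal_iff_ite.1 b.orthonormal, orthonormal_iff_ite.1 c.orthonormal]
      simp only [Prod.ext_iff]
      split_ifs <;> simp_all)
    (by
      set W := (Submodule.span ℂ (Set.range fun p : ι × κ => tmul (b p.1) (c p.2))).topologicalClosure
        with hW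
      have hWc : IsClosed (W : Set (HTensor H K)) := Submodule.isClosed_topologicalClosure _
      -- Density is obtained one factor at a time: first an arbitrary `y` beside a basis vector,
      -- then an arbitrary `x`.
      have h1 : ∀ i y, tmul (b i) y ∈ W := by
        intro i y
        have hle : (Submodule.span ℂ (Set.range c)).topologicalClosure ≤
            W.comap (tmulL K (b i)).toLinearMap := by
          refine Submodule.topologicalClosure_minimal _ (Submodule.span_le.2 ?_)
            (hWc.preimage (tmulL K (b i)).continuous)
          rintro _ ⟨j, rfl⟩
          exact Submodule.le_topologicalClosure _ (Submodule.subset_span ⟨(i, j), rfl⟩)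
        rw [c.dense_span] at hle
        exact hle Submodule.mem_top
      have h2 : ∀ x y, tmul x y ∈ W := by
        intro x y
        have hle : (Submodule.span ℂ (Set.range b)).topologicalClosure ≤
            W.comap (tmulR H y).toLinearMap := by
          refine Submodule.topologicalClosure_minimal _ (Submodule.span_le.2 ?_)
            (hWc.preimage (tmulR H y).continuous)
          rintro _ ⟨i, rfl⟩
          exact h1 i y
        rw [b.dense_span] at hle
        exact hle Submodule.mem_top
      have h3 := Submodule.dense_iff_topologicalClosure_eq_top.1 (dense_span_tmul (H := H) (K := K))
      rw [← h3]
      refine Submodule.topologicalClosure_minimal _ (Submodule.span_le.2 ?_) hWc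
      rintro _ ⟨p, rfl⟩
      exact h2 _ _)

omit [CompleteSpace H] [CompleteSpace K] in
theorem tensorBasis_apply (b : HilbertBasis ι ℂ H) (c : HilbertBasis κ ℂ K) (p : ι × κ) :
    tensorBasis b c p = tmul (b p.1) (c p.2) := by
  rw [tensorBasis, HilbertBasis.coe_mk]

omit [CompleteSpace H] [CompleteSpace K] in
theorem norm_tmul (x : H) (y : K) : ‖tmul x y‖ = ‖x‖ * ‖y‖ := by
  rw [tmul, UniformSpace.Completion.norm_coe, TensorProduct.norm_tmul]

theorem isDensityOperator_mul_self_iff {𝓗 : Type u} [NormedAddCommGroup 𝓗] [InnerProductSpace ℂ 𝓗]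
    [CompleteSpace 𝓗] {s : 𝓗 →L[ℂ] 𝓗} (hs : IsSelfAdjoint s) (b : HilbertBasis ι ℂ 𝓗) :
    IsDensityOperator (s * s) ↔ HasSum (fun i => ‖s (b i)‖ ^ 2) 1 := by
  constructor
  · intro h
    exact hasSum_norm_sq_of_hasTrace hs (by simpa using h.2) b
  · intro h
    refine ⟨(ContinuousLinearMap.nonneg_iff_isPositive _).1 hs.mul_self_nonneg, ?_⟩
    simpa using hasTrace_of_hasSum_norm_sq hs b h

/-- Product states are states. -/
theorem IsDensityOperator.tensorOp {ρ : H →L[ℂ] H} {σ : K →L[ℂ] K} (hρ : IsDensityOperator ρ)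
    (hσ : IsDensityOperator σ) : IsDensityOperator (tensorOp ρ σ) := by
  obtain ⟨r, hr, rfl⟩ := IsPositive.exists_sqrt hρ.1
  obtain ⟨s, hs, rfl⟩ := IsPositive.exists_sqrt hσ.1
  obtain ⟨w, b, -⟩ := exists_hilbertBasis ℂ H
  obtain ⟨w', c, -⟩ := exists_hilbertBasis ℂ K
  rw [isDensityOperator_mul_self_iff hr b] at hρ
  rw [isDensityOperator_mul_self_iff hs c] at hσ
  -- Since `r² ⊗ s² = (r ⊗ s)²`, the trace in the product basis is the product of two
  -- Hilbert–Schmidt sums.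
  rw [tensorOp_mul, isDensityOperator_mul_self_iff (isSelfAdjoint_tensorOp hr hs) (tensorBasis b c)]
  have h := hρ.mul hσ (hρ.summable.mul_of_nonneg hσ.summable (fun _ => sq_nonneg _)
    fun _ => sq_nonneg _)
  rw [one_mul] at h
  refine h.congr_fun fun p => ?_
  rw [tensorBasis_apply, tensorOp_tmul, norm_tmul, mul_pow]

end Tensor

/-! ### Step functions and bounded truncations of an operator. -/

namespace SpectralMeasure

theorem sum_mul_sum_of_orthogonal {R : Type*} [NonUnitalNonAssocSemiring R] {ι : Type*}
    (A : Finset ι) (a b : ι → R) (h : ∀ i j, i ≠ j → a i * b j = 0) :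
    (∑ i ∈ A, a i) * ∑ i ∈ A, b i = ∑ i ∈ A, a i * b i := by
  rw [Finset.sum_mul_sum]
  refine Finset.sum_congr rfl fun i hi => ?_
  exact Finset.sum_eq_single i (fun j _ hj => h i j hj.symm) fun hn => absurd hi hn

/-- The step function with the values `c j` on the sets `I j`. -/
noncomputable def stepFun (A : Finset ℤ) (I : ℤ → Set ℝ) (c : ℤ → ℝ) (x : ℝ) : ℝ :=
  ∑ j ∈ A, (I j).indicator (fun _ => c j) x

theorem measurable_stepFun (A : Finset ℤ) {I : ℤ → Set ℝ} (hI : ∀ j, MeasurableSet (I j))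
    (c : ℤ → ℝ) : Measurable (stepFun A I c) :=
  Finset.measurable_fun_sum _ fun j _ => measurable_const.indicator (hI j)

theorem stepFun_sq (A : Finset ℤ) {I : ℤ → Set ℝ} (hd : Pairwise (Function.onFun Disjoint I))
    (c : ℤ → ℝ) (x : ℝ) : stepFun A I c x ^ 2 = stepFun A I (fun j => c j ^ 2) x := by
  rw [sq, stepFun, sum_mul_sum_of_orthogonal]
  · refine Finset.sum_congr rfl fun j _ => ?_
    by_cases hx : x ∈ I j <;> simp [hx, sq]
  · intro i j hij
    by_cases hx : x ∈ I i
    · have : x ∉ I j := fun h => Set.disjoint_left.1 (hd hij) hx h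
      simp [this]
    · simp [hx]

variable {𝓗 : Type u} [NormedAddCommGroup 𝓗] [InnerProductSpace ℂ 𝓗] [CompleteSpace 𝓗]
variable (E : SpectralMeasure 𝓗)

/-- The integral of a step function with respect to a spectral measure. -/
noncomputable def stepOp (A : Finset ℤ) (I : ℤ → Set ℝ) (c : ℤ → ℝ) : 𝓗 →L[ℂ] 𝓗 :=
  ∑ j ∈ A, (c j : ℂ) • E (I j)

variable {A : Finset ℤ} {I : ℤ → Set ℝ} {c : ℤ → ℝ}

theorem isSelfAdjoint_stepOp (hI : ∀ j, MeasurableSet (I j)) : IsSelfAdjoint (E.stepOp A I c) := by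
  rw [IsSelfAdjoint, stepOp, star_sum]
  refine Finset.sum_congr rfl fun j _ => ?_
  rw [star_smul, (E.isProj _ (hI j)).isSelfAdjoint.star_eq]
  simp

theorem stepOp_mul_self (hI : ∀ j, MeasurableSet (I j)) (hd : Pairwise (Function.onFun Disjoint I)) :
    E.stepOp A I c * E.stepOp A I c = E.stepOp A I fun j => c j ^ 2 := by
  rw [stepOp, sum_mul_sum_of_orthogonal]
  · refine Finset.sum_congr rfl fun j _ => ?_
    rw [smul_mul_smul_comm, (E.isProj _ (hI j)).isIdempotentElem.eq, Complex.ofReal_pow, sq]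
  · intro i j hij
    rw [smul_mul_smul_comm, E.mul_eq_zero (hI i) (hI j) (hd hij), smul_zero]

theorem inner_stepOp (hI : ∀ j, MeasurableSet (I j)) (ψ : 𝓗) :
    ⟪ψ, E.stepOp A I c ψ⟫_ℂ = ((∫ x, stepFun A I c x ∂(E.scalar ψ) : ℝ) : ℂ) := by
  have h1 : ∫ x, stepFun A I c x ∂(E.scalar ψ) = ∑ j ∈ A, ‖E (I j) ψ‖ ^ 2 * c j := by
    simp only [stepFun]
    rw [integral_finsetSum _ fun j _ => (integrable_const _).indicator (hI j)]
    refine Finset.sum_congr rfl fun j _ => ?_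
    rw [integral_indicator_const _ (hI j), E.scalar_real (hI j), smul_eq_mul]
  rw [h1, stepOp, sum_apply, inner_sum, Complex.ofReal_sum]
  refine Finset.sum_congr rfl fun j _ => ?_
  rw [smul_apply, inner_smul_right, E.inner_self_apply (hI j), Complex.ofReal_mul, mul_comm]

theorem norm_stepOp_sq (hI : ∀ j, MeasurableSet (I j)) (hd : Pairwise (Function.onFun Disjoint I))
    (ψ : 𝓗) : ‖E.stepOp A I c ψ‖ ^ 2 = ∫ x, stepFun A I c x ^ 2 ∂(E.scalar ψ) := by
  simp only [stepFun_sq A hd]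
  rw [← Complex.ofReal_inj, ← inner_mul_self_apply (E.isSelfAdjoint_stepOp hI),
    E.stepOp_mul_self hI hd, E.inner_stepOp hI]

/-- `T` is the integral of `f` with respect to `E`, as a limit of integrals of step functions. -/
def IsStepLimit (T : 𝓗 →L[ℂ] 𝓗) (f : ℝ → ℝ) : Prop :=
  ∀ ε > 0, ∃ (A : Finset ℤ) (I : ℤ → Set ℝ) (c : ℤ → ℝ), (∀ j, MeasurableSet (I j)) ∧
    Pairwise (Function.onFun Disjoint I) ∧ ‖T - E.stepOp A I c‖ ≤ ε ∧
      ∀ x, |f x - stepFun A I c x| ≤ ε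

variable {E} in
-- Both formulas hold for step functions and pass to the limit by dominated convergence. The
-- approximation is in operator norm and uniform in `x`, so it survives tensoring with the identity.
theorem IsStepLimit.inner_and_norm {T : 𝓗 →L[ℂ] 𝓗} {f : ℝ → ℝ} (h : E.IsStepLimit T f) {C : ℝ}
    (hC : ∀ x, |f x| ≤ C) (ψ : 𝓗) :
    ⟪ψ, T ψ⟫_ℂ = ((∫ x, f x ∂(E.scalar ψ) : ℝ) : ℂ) ∧
      ‖T ψ‖ ^ 2 = ∫ x, f x ^ 2 ∂(E.scalar ψ) := by
  choose A I c hI hd hT hf using fun k : ℕ => h (1 / ((k : ℝ) + 1)) Nat.one_div_pos_of_nat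
  have h0 : Filter.Tendsto (fun k : ℕ => 1 / ((k : ℝ) + 1)) Filter.atTop (nhds 0) :=
    tendsto_one_div_add_atTop_nhds_zero_nat
  have h1 : Filter.Tendsto (fun k => E.stepOp (A k) (I k) (c k) ψ) Filter.atTop (nhds (T ψ)) := by
    have h2 : Filter.Tendsto (fun k => E.stepOp (A k) (I k) (c k)) Filter.atTop (nhds T) := by
      rw [tendsto_iff_norm_sub_tendsto_zero]
      refine squeeze_zero (fun _ => norm_nonneg _) (fun k => ?_) h0
      rw [norm_sub_rev]
      exact hT k
    exact ((ContinuousLinearMap.apply ℂ 𝓗 ψ).continuous.tendsto T).comp h2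
  have h2 : ∀ x, Filter.Tendsto (fun k => stepFun (A k) (I k) (c k) x) Filter.atTop
      (nhds (f x)) := by
    intro x
    rw [tendsto_iff_norm_sub_tendsto_zero]
    refine squeeze_zero (fun _ => norm_nonneg _) (fun k => ?_) h0
    rw [norm_sub_rev]
    exact hf k x
  have h3 : ∀ k x, |stepFun (A k) (I k) (c k) x| ≤ C + 1 := by
    intro k x
    have h4 : 1 / ((k : ℝ) + 1) ≤ 1 := by
      rw [div_le_one (by positivity)]
      linarith [Nat.cast_nonneg (α := ℝ) k]
    have h5 := abs_le.1 (hf k x)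
    have h6 := abs_le.1 (hC x)
    rw [abs_le]
    constructor <;> linarith
  constructor
  · have h4 := tendsto_integral_of_dominated_convergence (μ := E.scalar ψ) (fun _ => C + 1)
      (fun k => (measurable_stepFun (A k) (hI k) (c k)).aestronglyMeasurable)
      (integrable_const _) (fun k => Filter.Eventually.of_forall (h3 k))
      (Filter.Eventually.of_forall h2)
    have h5 := (Complex.continuous_ofReal.tendsto _).comp h4
    refine tendsto_nhds_unique ((tendsto_const_nhds (x := ψ)).inner h1) (h5.congr fun k => ?_)
    exact (E.inner_stepOp (hI k) ψ).symm
  · have h4 := tendsto_integral_of_dominated_convergence (μ := E.scalar ψ) (fun _ => (C + 1) ^ 2)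
      (fun k => ((measurable_stepFun (A k) (hI k) (c k)).pow_const 2).aestronglyMeasurable)
      (integrable_const _) (fun k => Filter.Eventually.of_forall fun x => by
        rw [Real.norm_eq_abs, abs_pow]
        gcongr
        exact h3 k x)
      (Filter.Eventually.of_forall fun x => (h2 x).pow 2)
    refine tendsto_nhds_unique (h1.norm.pow 2) (h4.congr fun k => ?_)
    exact (E.norm_stepOp_sq (hI k) (hd k) ψ).symm

theorem biUnion_eq_sum {ι : Type*} (A : Finset ι) {s : ι → Set ℝ} (hs : ∀ i, MeasurableSet (s i))
    (hd : Pairwise (Function.onFun Disjoint s)) : E (⋃ i ∈ A, s i) = ∑ i ∈ A, E (s i) := by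
  classical
  induction A using Finset.induction_on with
  | empty => simp [E.empty_eq]
  | insert a A ha ih =>
    rw [Finset.set_biUnion_insert, Finset.sum_insert ha,
      E.union_eq (hs a) (Finset.measurableSet_biUnion _ fun i _ => hs i), ih]
    rw [Set.disjoint_iUnion₂_right]
    exact fun i hi => hd fun h => ha (h ▸ hi)

namespace IsSpectralMeasureOf

variable {E} {X : 𝓗 →ₗ.[ℂ] 𝓗} (hE : E.IsSpectralMeasureOf X)

/-- The bounded operator `X E([-n, n])`. -/
noncomputable def trunc (n : ℕ) : 𝓗 →L[ℂ] 𝓗 :=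
  -- The endpoints have the shape `c ± R` with `c = 0`, `R = n`, so that `norm_truncLin_sub_le`
  -- bounds the norm by `n`.
  (hE.truncLin (measurableSet_Icc (a := (0 : ℝ) - n) (b := 0 + n)) subset_rfl).mkContinuous n
    fun x => by
      simpa using hE.norm_truncLin_sub_le (measurableSet_Icc (a := (0 : ℝ) - n) (b := 0 + n))
        n.cast_nonneg subset_rfl x

theorem trunc_apply (n : ℕ) (x : 𝓗) :
    hE.trunc n x = X ⟨E (Set.Icc (-(n : ℝ)) n) x,
      hE.apply_mem_domain_of_subset_Icc measurableSet_Icc subset_rfl x⟩ := by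
  have h : Set.Icc ((0 : ℝ) - n) (0 + n) = Set.Icc (-(n : ℝ)) n := by rw [zero_sub, zero_add]
  change X ⟨E (Set.Icc ((0 : ℝ) - n) (0 + n)) x, _⟩ = _
  congr 2
  rw [h]

theorem trunc_apply_coe (n : ℕ) (x : X.domain) :
    hE.trunc n x = E (Set.Icc (-(n : ℝ)) n) (X x) := by
  rw [trunc_apply, ← hE.map_apply measurableSet_Icc]

theorem apply_trunc {m n : ℕ} (h : m ≤ n) :
    E (Set.Icc (-(m : ℝ)) m) * hE.trunc n = hE.trunc m := by
  ext x
  rw [mul_apply_eq_comp, trunc_apply, trunc_apply, ← hE.map_apply measurableSet_Icc]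
  congr 2
  exact E.apply_apply_of_subset measurableSet_Icc measurableSet_Icc (monotone_Icc_nat h) x

theorem isSelfAdjoint_trunc (n : ℕ) : IsSelfAdjoint (hE.trunc n) :=
  (ContinuousLinearMap.isSelfAdjoint_iff_isSymmetric).2
    (hE.isSymmetric_truncLin (measurableSet_Icc (a := (0 : ℝ) - n) (b := 0 + n)) subset_rfl)

theorem inner_trunc (n : ℕ) (ψ : 𝓗) : ⟪ψ, hE.trunc n ψ⟫_ℂ =
    ((∫ x, (Set.Icc (-(n : ℝ)) n).indicator (fun x => x) x ∂(E.scalar ψ) : ℝ) : ℂ) := by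
  have h : E (Set.Icc (-(n : ℝ)) n) (hE.trunc n ψ) = hE.trunc n ψ := by
    rw [← mul_apply_eq_comp, hE.apply_trunc le_rfl]
  rw [← h, ← E.inner_apply_left measurableSet_Icc, trunc_apply, integral_indicator measurableSet_Icc,
    ← E.scalar_restrict measurableSet_Icc]
  exact hE.2 ⟨E (Set.Icc (-(n : ℝ)) n) ψ,
      hE.apply_mem_domain_of_subset_Icc measurableSet_Icc subset_rfl ψ⟩

/-- On `[-n, n]` the function `x` is replaced by `ε ⌊x / ε⌋`, at distance at most `ε`. Both
quadratic forms are integrals against a scalar measure of mass `‖ψ‖²`, so the numerical radius,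
hence the norm, of the difference is at most `ε`. -/
theorem isStepLimit_trunc (n : ℕ) :
    E.IsStepLimit (hE.trunc n) ((Set.Icc (-(n : ℝ)) n).indicator fun x => x) := by
  intro ε hε
  set J := Set.Icc (-(n : ℝ)) n with hJ
  set A : Finset ℤ := Finset.Icc ⌊-(n : ℝ) / ε⌋ ⌊(n : ℝ) / ε⌋ with hA
  set I : ℤ → Set ℝ := fun j => J ∩ (fun x : ℝ => ⌊x / ε⌋) ⁻¹' {j} with hIdef
  set c : ℤ → ℝ := fun j => ε * j with hc
  have hI : ∀ j, MeasurableSet (I j) := fun j =>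
    measurableSet_Icc.inter ((Int.measurable_floor.comp (measurable_id.div_const ε))
      (measurableSet_singleton j))
  have hd : Pairwise (Function.onFun Disjoint I) := fun i j hij =>
    Set.disjoint_left.2 fun x hi hj => hij (hi.2.symm.trans hj.2)
  have hf : ∀ x, |J.indicator (fun x => x) x - stepFun A I c x| ≤ ε := by
    intro x
    by_cases hx : x ∈ J
    · have h1 : stepFun A I c x = ε * ⌊x / ε⌋ := by
        rw [stepFun, Finset.sum_eq_single ⌊x / ε⌋]
        · exact Set.indicator_of_mem (show x ∈ I ⌊x / ε⌋ from ⟨hx, rfl⟩) _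
        · intro j _ hj
          exact Set.indicator_of_notMem (fun h => hj h.2.symm) _
        · intro hn
          refine absurd (Finset.mem_Icc.2 ⟨?_, ?_⟩) hn
          · exact Int.floor_le_floor (div_le_div_of_nonneg_right hx.1 hε.le)
          · exact Int.floor_le_floor (div_le_div_of_nonneg_right hx.2 hε.le)
      rw [Set.indicator_of_mem hx, h1]
      have h2 := Int.floor_le (x / ε)
      have h3 := Int.lt_floor_add_one (x / ε)
      rw [le_div_iff₀ hε] at h2
      rw [div_lt_iff₀ hε] at h3
      rw [abs_le]
      constructor <;> nlinarith
    · have h1 : stepFun A I c x = 0 :=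
        Finset.sum_eq_zero fun j _ => Set.indicator_of_notMem (fun h => hx h.1) _
      rw [Set.indicator_of_notMem hx, h1, sub_zero, abs_zero]
      exact hε.le
  have hint : ∀ ψ, Integrable (J.indicator fun x => x) (E.scalar ψ) := by
    intro ψ
    refine Integrable.of_bound (measurable_id.indicator measurableSet_Icc).aestronglyMeasurable n
      (Filter.Eventually.of_forall fun x => ?_)
    by_cases hx : x ∈ J
    · rw [Set.indicator_of_mem hx]
      exact abs_le.2 hx
    · rw [Set.indicator_of_notMem hx, norm_zero]
      exact n.cast_nonneg
  have hsint : ∀ ψ, Integrable (stepFun A I c) (E.scalar ψ) := fun ψ =>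
    integrable_finsetSum _ fun j _ => (integrable_const _).indicator (hI j)
  refine ⟨A, I, c, hI, hd, ?_, hf⟩
  have hsymm : (hE.trunc n - E.stepOp A I c).toLinearMap.IsSymmetric :=
    ContinuousLinearMap.isSelfAdjoint_iff_isSymmetric.1
      ((hE.isSelfAdjoint_trunc n).sub (E.isSelfAdjoint_stepOp hI))
  refine ContinuousLinearMap.opNorm_le_bound _ hε.le
    (norm_le_of_isSymmetric hsymm hε.le fun ψ => ?_)
  rw [ContinuousLinearMap.coe_coe, sub_apply, inner_sub_right, hE.inner_trunc n, E.inner_stepOp hI,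
    ← Complex.ofReal_sub, Complex.ofReal_re, ← integral_sub (hint ψ) (hsint ψ)]
  have h1 := norm_integral_le_of_norm_le_const (μ := E.scalar ψ) (C := ε)
    (f := fun x => J.indicator (fun x => x) x - stepFun A I c x) (Filter.Eventually.of_forall hf)
  rw [E.scalar_real MeasurableSet.univ, E.univ_eq] at h1
  exact h1

end IsSpectralMeasureOf

end SpectralMeasure

/-! ### The spectral measure of `X ⊗ 1`. -/

section Amplification

variable {H : Type u} [NormedAddCommGroup H] [InnerProductSpace ℂ H] [CompleteSpace H]
variable {K : Type v} [NormedAddCommGroup K] [InnerProductSpace ℂ K] [CompleteSpace K]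

omit [CompleteSpace H] [CompleteSpace K] in
theorem norm_tensorOp_one_le (S : H →L[ℂ] H) : ‖tensorOp S (1 : K →L[ℂ] K)‖ ≤ ‖S‖ :=
  (norm_tensorOp_le S 1).trans (mul_le_of_le_one_right (norm_nonneg _)
    ContinuousLinearMap.norm_id_le)

namespace SpectralMeasure

variable (E : SpectralMeasure H)

theorem norm_le_one {S : Set ℝ} (hS : MeasurableSet S) : ‖E S‖ ≤ 1 :=
  ContinuousLinearMap.opNorm_le_bound _ zero_le_one fun ψ => by
    rw [one_mul]
    exact E.norm_apply_le hS ψ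

omit [CompleteSpace H] [CompleteSpace K] in
theorem sum_tensorOp {ι : Type*} (A : Finset ι) (S : ι → H →L[ℂ] H) :
    ∑ i ∈ A, tensorOp (S i) (1 : K →L[ℂ] K) = tensorOp (∑ i ∈ A, S i) 1 :=
  (map_sum (tensorOpLin H (1 : K →L[ℂ] K)) S A).symm

omit [CompleteSpace K] in
-- Convergence is clear on elementary tensors. It extends to the closure of their span because the
-- partial sums are the contractions `E(⋃ Δₙ) ⊗ 1` over finite unions.
theorem hasSum_tensorOp (Δ : ℕ → Set ℝ) (hΔ : ∀ n, MeasurableSet (Δ n))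
    (hd : Pairwise (Function.onFun Disjoint Δ)) (hu : (⋃ n, Δ n) = Set.univ) (ψ : HTensor H K) :
    HasSum (fun n => tensorOp (E (Δ n)) (1 : K →L[ℂ] K) ψ) ψ := by
  set V : Submodule ℂ (HTensor H K) :=
    { carrier := {ψ | HasSum (fun n => tensorOp (E (Δ n)) (1 : K →L[ℂ] K) ψ) ψ}
      add_mem' := fun {a b} ha hb => by
        simpa only [Set.mem_ofPred_eq, map_add] using HasSum.add ha hb
      zero_mem' := by
        simpa only [Set.mem_ofPred_eq, map_zero] using hasSum_zero
      smul_mem' := fun c a ha => by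
        simpa only [Set.mem_ofPred_eq, map_smul] using HasSum.const_smul c ha } with hV
  have h1 : ∀ x y, tmul x y ∈ V := by
    intro x y
    change HasSum (fun n => tensorOp (E (Δ n)) (1 : K →L[ℂ] K) (tmul x y)) (tmul x y)
    simp only [tensorOp_tmul]
    exact (E.hasSum Δ hΔ hd hu x).mapL (tmulR H y)
  have hdense : Dense (V : Set (HTensor H K)) := by
    refine dense_span_tmul.mono (Submodule.span_le.2 ?_)
    rintro _ ⟨p, rfl⟩
    exact h1 _ _
  have hbound : ∀ (A : Finset ℕ) (χ : HTensor H K),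
      ‖∑ n ∈ A, tensorOp (E (Δ n)) (1 : K →L[ℂ] K) χ‖ ≤ ‖χ‖ := by
    intro A χ
    rw [← sum_apply, sum_tensorOp, ← E.biUnion_eq_sum A hΔ hd]
    refine (ContinuousLinearMap.le_opNorm _ _).trans
      (mul_le_of_le_one_left (norm_nonneg _) ((norm_tensorOp_one_le _).trans (E.norm_le_one ?_)))
    exact Finset.measurableSet_biUnion _ fun i _ => hΔ i
  rw [HasSum, Metric.tendsto_nhds]
  intro ε hε
  obtain ⟨φ, hφ, hφψ⟩ := Metric.mem_closure_iff.1 (hdense ψ) (ε / 3) (by positivity)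
  filter_upwards [Metric.tendsto_nhds.1 hφ (ε / 3) (by positivity)] with A hA
  rw [dist_eq_norm] at *
  have h2 := hbound A (ψ - φ)
  simp only [map_sub, Finset.sum_sub_distrib] at h2
  set a := ∑ n ∈ A, tensorOp (E (Δ n)) (1 : K →L[ℂ] K) ψ
  set b := ∑ n ∈ A, tensorOp (E (Δ n)) (1 : K →L[ℂ] K) φ
  calc ‖a - ψ‖ = ‖(a - b) + (b - φ) - (ψ - φ)‖ := by congr 1; abel
    _ ≤ ‖a - b‖ + ‖b - φ‖ + ‖ψ - φ‖ :=
      (norm_sub_le _ _).trans (add_le_add_left (norm_add_le _ _) _)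
    _ < ε := by linarith

variable (K) in
/-- The spectral measure `Δ ↦ E(Δ) ⊗ 1`. -/
noncomputable def amp : SpectralMeasure (HTensor H K) where
  toFun Δ := tensorOp (E Δ) 1
  isProj Δ hΔ := isStarProjection_tensorOp (E.isProj Δ hΔ) (.one _)
  hasSum := E.hasSum_tensorOp

theorem amp_apply (Δ : Set ℝ) : E.amp K Δ = tensorOp (E Δ) 1 := rfl

theorem amp_stepOp (A : Finset ℤ) (I : ℤ → Set ℝ) (c : ℤ → ℝ) :
    (E.amp K).stepOp A I c = tensorOp (E.stepOp A I c) 1 := by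
  rw [stepOp, stepOp, ← sum_tensorOp]
  simp only [amp_apply, tensorOp_smul_left]

variable {E}

theorem IsStepLimit.amp {T : H →L[ℂ] H} {f : ℝ → ℝ} (h : E.IsStepLimit T f) :
    (E.amp K).IsStepLimit (tensorOp T 1) f := by
  intro ε hε
  obtain ⟨A, I, c, hI, hd, hT, hf⟩ := h ε hε
  refine ⟨A, I, c, hI, hd, ?_, hf⟩
  have h1 : tensorOp T (1 : K →L[ℂ] K) - (E.amp K).stepOp A I c =
      tensorOp (T - E.stepOp A I c) 1 := by
    rw [amp_stepOp]
    exact (map_sub (tensorOpLin H (1 : K →L[ℂ] K)) _ _).symm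
  rw [h1]
  exact (norm_tensorOp_one_le _).trans hT

namespace IsSpectralMeasureOf

variable {X : H →ₗ.[ℂ] H} (hE : E.IsSpectralMeasureOf X)

variable (K) in
/-- The graph of `X ⊗ 1`. -/
noncomputable def ampGraph (X : H →ₗ.[ℂ] H) : Submodule ℂ (HTensor H K × HTensor H K) :=
  (Submodule.span ℂ {p : HTensor H K × HTensor H K |
    ∃ (x : X.domain) (y : K), p = (tmul (x : H) y, tmul (X x) y)}).topologicalClosure

variable (K) in
/-- The bounded operator `X E([-n, n]) ⊗ 1`. -/
noncomputable def ampTrunc (n : ℕ) : HTensor H K →L[ℂ] HTensor H K := tensorOp (hE.trunc n) 1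

/-- The condition is linear and closed in `(ψ, χ)`, so the generators of the graph suffice. Letting
`n` grow, it recovers `χ` from `ψ`. -/
theorem amp_apply_snd_of_mem (n : ℕ) {ψ χ : HTensor H K} (hp : (ψ, χ) ∈ ampGraph K X) :
    E.amp K (Set.Icc (-(n : ℝ)) n) χ = hE.ampTrunc K n ψ := by
  set L : HTensor H K × HTensor H K →L[ℂ] HTensor H K :=
    E.amp K (Set.Icc (-(n : ℝ)) n) ∘L ContinuousLinearMap.snd ℂ _ _ -
      hE.ampTrunc K n ∘L ContinuousLinearMap.fst ℂ _ _ with hL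
  have h : ampGraph K X ≤ L.ker := by
    refine Submodule.topologicalClosure_minimal _ (Submodule.span_le.2 ?_) L.isClosed_ker
    rintro _ ⟨x, y, rfl⟩
    change E.amp K (Set.Icc (-(n : ℝ)) n) (tmul (X x) y) - hE.ampTrunc K n (tmul (x : H) y) = 0
    rw [amp_apply, ampTrunc, tensorOp_tmul, tensorOp_tmul, hE.trunc_apply_coe, sub_self]
  exact sub_eq_zero.1 (h hp)

theorem mk_mem_ampGraph (n : ℕ) (ψ : HTensor H K) :
    (E.amp K (Set.Icc (-(n : ℝ)) n) ψ, hE.ampTrunc K n ψ) ∈ ampGraph K X := by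
  set L : HTensor H K →L[ℂ] HTensor H K × HTensor H K :=
    (E.amp K (Set.Icc (-(n : ℝ)) n)).prod (hE.ampTrunc K n) with hL
  have hc : IsClosed ((ampGraph K X).comap L.toLinearMap : Set (HTensor H K)) :=
    (Submodule.isClosed_topologicalClosure _).preimage L.continuous
  have h : (Submodule.span ℂ (Set.range fun p : H × K => tmul p.1 p.2)).topologicalClosure ≤
      (ampGraph K X).comap L.toLinearMap := by
    refine Submodule.topologicalClosure_minimal _ (Submodule.span_le.2 ?_) hc
    rintro _ ⟨⟨x, y⟩, rfl⟩
    refine Submodule.le_topologicalClosure _ (Submodule.subset_span ⟨⟨E (Set.Icc (-(n : ℝ)) n) x,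
      hE.apply_mem_domain_of_subset_Icc measurableSet_Icc subset_rfl x⟩, y, ?_⟩)
    change (E.amp K (Set.Icc (-(n : ℝ)) n) (tmul x y), hE.ampTrunc K n (tmul x y)) = _
    rw [amp_apply, ampTrunc, tensorOp_tmul, tensorOp_tmul, hE.trunc_apply]
    rfl
  rw [Submodule.dense_iff_topologicalClosure_eq_top.1 dense_span_tmul] at h
  exact h (Submodule.mem_top (x := ψ))

include hE in
-- Single-valuedness of the closure is what lets `toLinearPMap` have it as graph.
theorem snd_eq_zero_of_mem_ampGraph (p : HTensor H K × HTensor H K) (hp : p ∈ ampGraph K X)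
    (h0 : p.1 = 0) : p.2 = 0 := by
  have h1 := (E.amp K).tendsto_apply_Icc p.2
  simp only [hE.amp_apply_snd_of_mem _ hp, h0, map_zero] at h1
  exact tendsto_nhds_unique h1 tendsto_const_nhds

omit [CompleteSpace H] [CompleteSpace K] in
theorem mem_domain_ampLeft {ψ : HTensor H K} :
    ψ ∈ (ampLeft X : HTensor H K →ₗ.[ℂ] HTensor H K).domain ↔ ∃ χ, (ψ, χ) ∈ ampGraph K X := by
  rw [ampLeft, Submodule.toLinearPMap_domain, Submodule.mem_map, Prod.exists]
  constructor
  · rintro ⟨_, χ, h, rfl⟩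
    exact ⟨χ, h⟩
  · rintro ⟨χ, h⟩
    exact ⟨ψ, χ, h, rfl⟩

include hE in
theorem mem_ampGraph (ψ : (ampLeft X : HTensor H K →ₗ.[ℂ] HTensor H K).domain) :
    ((ψ : HTensor H K), ampLeft X ψ) ∈ ampGraph K X :=
  Submodule.mem_graph_toLinearPMap hE.snd_eq_zero_of_mem_ampGraph ψ

theorem inner_ampTrunc_and_norm (n : ℕ) (ψ : HTensor H K) :
    ⟪ψ, hE.ampTrunc K n ψ⟫_ℂ = ((∫ x in Set.Icc (-(n : ℝ)) n, x ∂((E.amp K).scalar ψ) : ℝ) : ℂ) ∧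
      ‖hE.ampTrunc K n ψ‖ ^ 2 = ∫ x in Set.Icc (-(n : ℝ)) n, x ^ 2 ∂((E.amp K).scalar ψ) := by
  have h := ((hE.isStepLimit_trunc n).amp (K := K)).inner_and_norm (C := n) (fun x => by
    by_cases hx : x ∈ Set.Icc (-(n : ℝ)) n
    · rw [Set.indicator_of_mem hx]
      exact abs_le.2 hx
    · rw [Set.indicator_of_notMem hx, abs_zero]
      exact n.cast_nonneg) ψ
  rw [← integral_indicator measurableSet_Icc, ← integral_indicator measurableSet_Icc]
  refine ⟨h.1, h.2.trans (integral_congr_ae (Filter.Eventually.of_forall fun x => ?_))⟩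
  by_cases hx : x ∈ Set.Icc (-(n : ℝ)) n
  · simp only [Set.indicator_of_mem hx]
  · simp only [Set.indicator_of_notMem hx]
    norm_num

theorem aecover_Icc_nat (μ : Measure ℝ) :
    AECover μ Filter.atTop fun n : ℕ => Set.Icc (-(n : ℝ)) n :=
  aecover_Icc (Filter.tendsto_neg_atTop_atBot.comp tendsto_natCast_atTop_atTop)
    tendsto_natCast_atTop_atTop

theorem amp_apply_ampTrunc {m n : ℕ} (h : m ≤ n) (ψ : HTensor H K) :
    E.amp K (Set.Icc (-(m : ℝ)) m) (hE.ampTrunc K n ψ) = hE.ampTrunc K m ψ := by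
  rw [← mul_apply_eq_comp, amp_apply, ampTrunc, ← tensorOp_mul, hE.apply_trunc h, one_mul, ampTrunc]

theorem norm_ampTrunc_sub_sq {m n : ℕ} (h : m ≤ n) (ψ : HTensor H K) :
    ‖hE.ampTrunc K n ψ - hE.ampTrunc K m ψ‖ ^ 2 =
      ‖hE.ampTrunc K n ψ‖ ^ 2 - ‖hE.ampTrunc K m ψ‖ ^ 2 := by
  have h1 := (E.amp K).norm_sub_sq (measurableSet_Icc (a := -(m : ℝ)) (b := m))
    MeasurableSet.univ (Set.subset_univ _) (hE.ampTrunc K n ψ)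
  rwa [(E.amp K).univ_eq, one_apply_eq_self, hE.amp_apply_ampTrunc h] at h1

include hE in
-- The squared norms of the truncations at `ψ` converge to the second moment, and by Pythagoras
-- their differences are squared distances. So the truncations form a Cauchy sequence, and the
-- closed graph contains the limit pair.
theorem exists_mem_ampGraph {ψ : HTensor H K}
    (h : Integrable (fun x : ℝ => x ^ 2) ((E.amp K).scalar ψ)) : ∃ χ, (ψ, χ) ∈ ampGraph K X := by
  have h1 := (aecover_Icc_nat ((E.amp K).scalar ψ)).integral_tendsto_of_countably_generated h
  simp only [← (hE.inner_ampTrunc_and_norm _ ψ).2] at h1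
  have hcauchy : CauchySeq fun n => hE.ampTrunc K n ψ := by
    rw [Metric.cauchySeq_iff']
    intro ε hε
    obtain ⟨N, hN⟩ := Metric.cauchySeq_iff'.1 h1.cauchySeq (ε ^ 2) (by positivity)
    refine ⟨N, fun n hn => ?_⟩
    have h2 := hN n hn
    rw [Real.dist_eq, ← hE.norm_ampTrunc_sub_sq hn] at h2
    rw [dist_eq_norm]
    exact lt_of_pow_lt_pow_left₀ 2 hε.le ((le_abs_self _).trans_lt h2)
  obtain ⟨χ, hχ⟩ := cauchySeq_tendsto_of_complete hcauchy
  exact ⟨χ, (Submodule.isClosed_topologicalClosure _).mem_of_tendsto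
    (((E.amp K).tendsto_apply_Icc ψ).prodMk_nhds hχ)
    (Filter.Eventually.of_forall fun n => hE.mk_mem_ampGraph n ψ)⟩

include hE in
-- The second moment over `[-n, n]` is `‖(E([-n, n]) ⊗ 1) χ‖²`, bounded by `‖χ‖²` uniformly in `n`.
theorem integrable_sq_of_mem_ampGraph {ψ χ : HTensor H K} (hp : (ψ, χ) ∈ ampGraph K X) :
    Integrable (fun x : ℝ => x ^ 2) ((E.amp K).scalar ψ) := by
  refine (aecover_Icc_nat _).integrable_of_integral_bounded_of_nonneg_ae (‖χ‖ ^ 2) (fun n => ?_)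
    (Filter.Eventually.of_forall fun x => sq_nonneg x) (Filter.Eventually.of_forall fun n => ?_)
  · exact (continuous_pow 2).continuousOn.integrableOn_compact isCompact_Icc
  · rw [← (hE.inner_ampTrunc_and_norm n ψ).2, ← hE.amp_apply_snd_of_mem n hp]
    gcongr
    exact (E.amp K).norm_apply_le measurableSet_Icc χ

include hE in
variable (K) in
/-- The spectral measure of `X ⊗ 1` is `Δ ↦ E(Δ) ⊗ 1`. -/
theorem amp : (E.amp K).IsSpectralMeasureOf (ampLeft X) := by
  refine ⟨fun ψ => ?_, fun ψ => ?_⟩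
  · rw [mem_domain_ampLeft]
    exact ⟨fun ⟨_, hχ⟩ => hE.integrable_sq_of_mem_ampGraph hχ, fun h => hE.exists_mem_ampGraph h⟩
  · have hmem := hE.mem_ampGraph ψ
    have h1 := (aecover_Icc_nat _).integral_tendsto_of_countably_generated
      (integrable_id_of_sq (hE.integrable_sq_of_mem_ampGraph hmem))
    have h2 := (Complex.continuous_ofReal.tendsto _).comp h1
    have h3 := (tendsto_const_nhds (x := (ψ : HTensor H K))).inner (𝕜 := ℂ)
      ((E.amp K).tendsto_apply_Icc (ampLeft X ψ))
    refine tendsto_nhds_unique h3 (h2.congr fun n => ?_)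
    rw [Function.comp_apply, ← (hE.inner_ampTrunc_and_norm n (ψ : HTensor H K)).1,
      hE.amp_apply_snd_of_mem n hmem]

end IsSpectralMeasureOf

end SpectralMeasure

end Amplification

/-! ### Equality in product states and partial traces. -/

section Measurement

variable {H : Type u} [NormedAddCommGroup H] [InnerProductSpace ℂ H] [CompleteSpace H]
variable {K : Type v} [NormedAddCommGroup K] [InnerProductSpace ℂ K] [CompleteSpace K]

omit [CompleteSpace H] [CompleteSpace K] in
theorem smul_tmul (c : ℂ) (x : H) (y : K) : tmul (c • x) y = c • tmul x y :=
  (tmulR H y).map_smul c x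

theorem isDensityOperator_starProjection_unit {u : H} (hu : ‖u‖ = 1) :
    IsDensityOperator (ℂ ∙ u).starProjection := by
  have hp : IsStarProjection (ℂ ∙ u).starProjection := isStarProjection_starProjection
  obtain ⟨w, b, -⟩ := exists_hilbertBasis ℂ H
  rw [← hp.isIdempotentElem.eq, isDensityOperator_mul_self_iff hp.isSelfAdjoint b]
  have h := hasSum_norm_inner_sq b u
  rw [hu, one_pow] at h
  refine h.congr_fun fun i => ?_
  rw [Submodule.starProjection_unit_singleton ℂ hu, norm_smul, hu, mul_one, ← inner_conj_symm,
    RCLike.norm_conj]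

theorem SpectralMeasure.amp_apply_tmul (E : SpectralMeasure H) (Δ : Set ℝ) (x : H) (y : K) :
    E.amp K Δ (tmul x y) = tmul (E Δ x) y := by
  rw [amp_apply, tensorOp_tmul]
  rfl

/-- Equality of `X` and `Y` in a state `τ` means that their spectral measures agree on the range
of `τ`. -/
theorem equalInState_iff {X Y : H →ₗ.[ℂ] H} {E F : SpectralMeasure H}
    (hE : E.IsSpectralMeasureOf X) (hF : F.IsSpectralMeasureOf Y) {τ : H →L[ℂ] H}
    (hτ : IsDensityOperator τ) :
    EqualInState X Y τ ↔ ∀ Δ : Set ℝ, MeasurableSet Δ → ∀ ψ, E Δ (τ ψ) = F Δ (τ ψ) := by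
  constructor
  · rintro ⟨E', F', hE', hF', h⟩ Δ hΔ ψ
    have h1 := (SpectralMeasure.mem_eqVal_iff E' F').1
      ((hasTrace_starProjection_comp_iff hτ _).1 h ψ)
    refine SpectralMeasure.apply_eq_of_forall_Iic (fun r => ?_) hΔ
    -- The definition supplies its own spectral measures; uniqueness identifies them with `E` and
    -- `F` on half-lines.
    rw [hE.apply_Iic_eq hE', hF.apply_Iic_eq hF']
    exact h1 r
  · intro h
    exact ⟨E, F, hE, hF, (hasTrace_starProjection_comp_iff hτ _).2 fun ψ =>
      (SpectralMeasure.mem_eqVal_iff E F).2 fun r => h _ measurableSet_Iic ψ⟩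

omit [CompleteSpace H] [CompleteSpace K] in
-- Each term factors, and the sum is `⟪ξ, S η⟫` times `Tr σ = 1`.
theorem isPartialTrace_of_apply_tmul {T : HTensor H K →L[ℂ] HTensor H K} {S : H →L[ℂ] H}
    {σ : K →L[ℂ] K} (hσ : IsDensityOperator σ)
    (h : ∀ x y, T (tmul x (σ y)) = tmul (S x) (σ y)) :
    IsPartialTrace (T ∘L tensorOp 1 σ) S := by
  intro ξ η ι f
  have h1 := (hσ.2 ι f).mul_left ⟪ξ, S η⟫_ℂ
  rw [mul_one] at h1
  refine h1.congr_fun fun j => ?_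
  rw [ContinuousLinearMap.comp_apply, tensorOp_tmul, one_apply_eq_self, h, inner_tmul]

omit [CompleteSpace H] in
theorem IsPartialTrace.unique {T : HTensor H K →L[ℂ] HTensor H K} {R S : H →L[ℂ] H}
    (hR : IsPartialTrace T R) (hS : IsPartialTrace T S) : R = S := by
  obtain ⟨w, f, -⟩ := exists_hilbertBasis ℂ K
  ext η
  exact ext_inner_left ℂ fun ξ => (hR ξ η w f).unique (hS ξ η w f)

omit [CompleteSpace H] in
-- With `V y = F(Δ)(φ ⊗ y)` and `σ = s²`, the number `⟪φ, R φ⟫ = 0` is the trace of `V† V s²`. Hence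
-- `V s = 0`, and so `V σ = 0`.
theorem apply_tmul_eq_zero {F : SpectralMeasure (HTensor H K)} {Δ : Set ℝ} (hΔ : MeasurableSet Δ)
    {σ : K →L[ℂ] K} (hσ : IsDensityOperator σ) {R : H →L[ℂ] H}
    (h : IsPartialTrace (F Δ ∘L tensorOp 1 σ) R) {φ : H} (hφ : R φ = 0) (y : K) :
    F Δ (tmul φ (σ y)) = 0 := by
  obtain ⟨s, hs, rfl⟩ := IsPositive.exists_sqrt hσ.1
  obtain ⟨w, f, -⟩ := exists_hilbertBasis ℂ K
  have hsum := ((isDensityOperator_mul_self_iff hs f).1 hσ).summable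
  have h1 : HasSum (fun j => ⟪(F Δ ∘L tmulL K φ) (f j), (F Δ ∘L tmulL K φ) (s (s (f j)))⟫_ℂ) 0 := by
    have h2 := h φ φ w f
    rw [hφ, inner_zero_right] at h2
    refine h2.congr_fun fun j => ?_
    simp only [ContinuousLinearMap.comp_apply, tmulL_apply, tensorOp_tmul]
    rw [F.inner_apply_left hΔ, F.apply_self hΔ]
    rfl
  have h2 := comp_eq_zero_of_hasSum_zero hs f hsum _ h1
  exact congrArg (fun T : K →L[ℂ] HTensor H K => T (s y)) h2

/-- A spectral measure on `H ⊗ K` whose partial traces are the projections `E(Δ)` acts on the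
vectors in the range of `1 ⊗ σ` as `E ⊗ 1` does. -/
theorem apply_tmul_of_isPartialTrace {E : SpectralMeasure H} {F : SpectralMeasure (HTensor H K)}
    {σ : K →L[ℂ] K} (hσ : IsDensityOperator σ)
    (h : ∀ Δ, MeasurableSet Δ → IsPartialTrace (F Δ ∘L tensorOp 1 σ) (E Δ)) {Δ : Set ℝ}
    (hΔ : MeasurableSet Δ) (x : H) (y : K) : F Δ (tmul x (σ y)) = tmul (E Δ x) (σ y) := by
  -- In `x = E(Δ)x + E(Δᶜ)x`, the projection `F(Δ)` kills the tensor of the second part with `σy`,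
  -- and fixes that of the first because `F(Δᶜ)` kills it.
  have h1 : F Δ (tmul (E Δᶜ x) (σ y)) = 0 := by
    refine apply_tmul_eq_zero hΔ hσ (h Δ hΔ) ?_ y
    rw [E.apply_apply hΔ hΔ.compl, Set.inter_compl_self, E.apply_empty]
  have h2 : F Δᶜ (tmul (E Δ x) (σ y)) = 0 := by
    refine apply_tmul_eq_zero hΔ.compl hσ (h Δᶜ hΔ.compl) ?_ y
    rw [E.apply_apply hΔ.compl hΔ, Set.compl_inter_self, E.apply_empty]
  rw [F.compl_eq hΔ, sub_apply, one_apply_eq_self, sub_eq_zero] at h2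
  rw [E.compl_eq hΔ, sub_apply, one_apply_eq_self, ← tmulR_apply, map_sub, map_sub,
    sub_eq_zero, tmulR_apply, tmulR_apply] at h1
  rw [h1, ← h2]

end Measurement

end QMeas

theorem mainTheorem12
    {H : Type*} [NormedAddCommGroup H] [InnerProductSpace ℂ H] [CompleteSpace H]
    {K : Type*} [NormedAddCommGroup K] [InnerProductSpace ℂ K] [CompleteSpace K]
    (M : VonNeumannAlgebra H)
    -- a measuring process for `M` and its POVM `povm`
    (P : QMeas.MeasuringProcess K M)
    (povm : Set ℝ → H →L[ℂ] H) (hpovm : P.IsPOVM povm)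
    -- an observable `A` of the system described by `M`, and its spectral measure `E`
    (A : H →ₗ.[ℂ] H) (hA : QMeas.IsObservable M A)
    (E : QMeas.SpectralMeasure H) (hE : E.IsSpectralMeasureOf A) :
    (∀ ρ : H →L[ℂ] H, QMeas.IsDensityOperator ρ → P.Measures A ρ) ↔
      ∀ Δ : Set ℝ, MeasurableSet Δ → povm Δ = E Δ := by
  obtain ⟨F, hF, hpov⟩ := hpovm
  have hiff : ∀ ρ : H →L[ℂ] H, QMeas.IsDensityOperator ρ → (P.Measures A ρ ↔
      ∀ Δ : Set ℝ, MeasurableSet Δ → ∀ ψ, E.amp K Δ (QMeas.tensorOp ρ P.σ ψ) =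
        F Δ (QMeas.tensorOp ρ P.σ ψ)) := fun ρ hρ =>
    QMeas.equalInState_iff (hE.amp K) hF (hρ.tensorOp P.isDensity)
  constructor
  · intro h Δ hΔ
    have key : ∀ x y, F Δ (QMeas.tmul x (P.σ y)) = QMeas.tmul (E Δ x) (P.σ y) := by
      intro x y
      by_cases hx : x = 0
      · rw [hx, ← QMeas.tmulR_apply, ← QMeas.tmulR_apply, map_zero, map_zero, map_zero, map_zero]
      · set u : H := ((‖x‖⁻¹ : ℝ) : ℂ) • x with hu
        have hu1 : ‖u‖ = 1 := by
          rw [hu, norm_smul, Complex.norm_real, norm_inv, norm_norm,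
            inv_mul_cancel₀ (norm_ne_zero_iff.2 hx)]
        -- The test state is the projection on the line of `u`, which fixes `u`; so `u ⊗ σy` lies in
        -- the range of `ρ ⊗ σ`.
        have hρ := QMeas.isDensityOperator_starProjection_unit hu1
        have h1 := (hiff _ hρ).1 (h _ hρ) Δ hΔ (QMeas.tmul u y)
        rw [QMeas.tensorOp_tmul, Submodule.starProjection_unit_singleton ℂ hu1,
          inner_self_eq_norm_sq_to_K, hu1, QMeas.SpectralMeasure.amp_apply_tmul] at h1
        have hxu : x = (‖x‖ : ℂ) • u := by
          rw [hu, smul_smul, ← Complex.ofReal_mul, mul_inv_cancel₀ (norm_ne_zero_iff.2 hx),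
            Complex.ofReal_one, one_smul]
        simp only [Complex.coe_algebraMap, Complex.ofReal_one, one_pow, one_smul] at h1
        clear_value u
        rw [hxu, map_smul, QMeas.smul_tmul, QMeas.smul_tmul, map_smul, h1]
    exact (hpov Δ hΔ).unique (QMeas.isPartialTrace_of_apply_tmul P.isDensity key)
  · intro h ρ hρ
    rw [hiff ρ hρ]
    intro Δ hΔ ψ
    have key := QMeas.apply_tmul_of_isPartialTrace (E := E) P.isDensity
      (fun S hS => h S hS ▸ hpov S hS) hΔ
    -- By density only `ρx ⊗ σy` matters, and there the identity on the range of `1 ⊗ σ` applies for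
    -- any `ρ`.
    have hop : E.amp K Δ ∘L QMeas.tensorOp ρ P.σ = F Δ ∘L QMeas.tensorOp ρ P.σ :=
      QMeas.ext_tmul fun x y => by
        rw [ContinuousLinearMap.comp_apply, ContinuousLinearMap.comp_apply, QMeas.tensorOp_tmul,
          key, QMeas.SpectralMeasure.amp_apply_tmul]
    exact congrArg (fun T : QMeas.HTensor H K →L[ℂ] QMeas.HTensor H K => T ψ) hop
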